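/- Let $n\ge 1$ be an integer and $\beta\in\mathbb{C}$. Let $\mathsf{TL}_n$ be the unital associative complex algebra generated by $u_1,\dots,u_{n-1}$ subject to the relations $$u_i^2=\beta u_i,\qquad u_iu_{i\pm1}u_i=u_i,\qquad u_iu_j=u_ju_i\ \text{ if } |i-j|>1,$$ whenever the indices lie in $\{1,\dots,n-1\}$. An $n$-diagram consists of two parallel vertical lines with $n$ marked points on each, the $2n$ points being connected pairwise by $n$ links which lie between the lines and do not intersect (diagrams are identified if they link the same pairs of points). The $n$-diagram algebra is the complex vector space with basis the set of $n$-diagrams, with the bilinear product for which the product of two diagrams $d$ and $e$ is $\beta^{m}$ times the diagram obtained by placing $d$ to the left of $e$, identifying the right line of $d$ with the left line of $e$, and removing this interior line together with the $m$ closed interior loops. It is an associative algebra whose unit is the diagram linking each point to the opposite one. Then the algebras $\mathsf{TL}_n$ and the $n$-diagram algebra are isomorphic, through the isomorphism of unital algebras that sends each $u_i$ to the diagram in which the points $i$ and $i+1$ on the left line are linked, the points $i$ and $i+1$ on the right line are linked, and every other point is linked to the opposite one. Both algebras are finite-dimensional, and their common dimension is the $n$-th Catalan number $$\dim \mathsf{TL}_n=\binom{2n}{n}-\binom{2n}{n-1}=\frac{1}{n+1}\binom{2n}{n}.$$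 -/

import Mathlib

/-! ## The abstract algebra -/

/-- The defining relations of the Temperley–Lieb algebra. The index set `{1, …, n - 1}` of the
generators is `Fin (n - 1)`, with indices shifted by one. -/
inductive TemperleyLieb.Rel (n : ℕ) (β : ℂ) :
    FreeAlgebra ℂ (Fin (n - 1)) → FreeAlgebra ℂ (Fin (n - 1)) → Prop
  | sq (i : Fin (n - 1)) :
      TemperleyLieb.Rel n β (FreeAlgebra.ι ℂ i * FreeAlgebra.ι ℂ i) (β • FreeAlgebra.ι ℂ i)
  | neighbour (i j : Fin (n - 1)) (h : (i : ℕ) + 1 = j ∨ (j : ℕ) + 1 = i) :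
      TemperleyLieb.Rel n β
        (FreeAlgebra.ι ℂ i * FreeAlgebra.ι ℂ j * FreeAlgebra.ι ℂ i) (FreeAlgebra.ι ℂ i)
  | comm (i j : Fin (n - 1)) (h : 1 < |((i : ℕ) : ℤ) - ((j : ℕ) : ℤ)|) :
      TemperleyLieb.Rel n β
        (FreeAlgebra.ι ℂ i * FreeAlgebra.ι ℂ j) (FreeAlgebra.ι ℂ j * FreeAlgebra.ι ℂ i)

/-- The abstract Temperley–Lieb algebra: the unital associative complex algebra given by
generators and relations. -/
abbrev TemperleyLieb (n : ℕ) (β : ℂ) : Type := RingQuot (TemperleyLieb.Rel n β)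

/-- The generator `u_i` of the abstract Temperley–Lieb algebra. -/
def TemperleyLieb.u (n : ℕ) (β : ℂ) (i : Fin (n - 1)) : TemperleyLieb n β :=
  RingQuot.mkAlgHom ℂ (TemperleyLieb.Rel n β) (FreeAlgebra.ι ℂ i)

/-! ## Diagrams -/

/-- The `2n` marked points: `inl i` on the left line and `inr j` on the right line, both numbered
from top to bottom. `boundaryPos` is the position of a point when one runs once around the
boundary of the strip, down the left line and then up the right line. -/
def boundaryPos {n : ℕ} : Fin n ⊕ Fin n → ℕ
  | Sum.inl i => i
  | Sum.inr j => 2 * n - 1 - j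

/-- An `n`-diagram: the `2n` marked points are connected pairwise by links (`link p` is the point
linked to `p`), and no two links cross, i.e. the end points of no two links interlace on the
boundary. -/
@[ext]
structure NDiagram (n : ℕ) where
  link : Fin n ⊕ Fin n → Fin n ⊕ Fin n
  link_link : ∀ p, link (link p) = p
  link_ne : ∀ p, link p ≠ p
  planar : ∀ p q, ¬ (boundaryPos p < boundaryPos q ∧ boundaryPos q < boundaryPos (link p) ∧
    boundaryPos (link p) < boundaryPos (link q))

namespace NDiagram

/-- The diagram in which every point is linked to the point opposite to it. -/
protected def one (n : ℕ) : NDiagram n where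
  link := Sum.swap
  link_link := by simp
  link_ne := by rintro (i | i) <;> simp
  planar := by
    rintro (⟨i, hi⟩ | ⟨i, hi⟩) (⟨j, hj⟩ | ⟨j, hj⟩) <;> simp [boundaryPos] <;> omega

/-- The points linked to each other by the diagram of `u_i`: the points `i` and `i + 1` on the
left, the points `i` and `i + 1` on the right, and all other points with their opposite points. -/
def genLink {n : ℕ} (i : Fin (n - 1)) : Fin n ⊕ Fin n → Fin n ⊕ Fin n
  | Sum.inl k =>
      if (k : ℕ) = i then Sum.inl ⟨i + 1, by omega⟩
      else if (k : ℕ) = i + 1 then Sum.inl ⟨i, by omega⟩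
      else Sum.inr k
  | Sum.inr k =>
      if (k : ℕ) = i then Sum.inr ⟨i + 1, by omega⟩
      else if (k : ℕ) = i + 1 then Sum.inr ⟨i, by omega⟩
      else Sum.inl k

/-- The diagram identified with the generator `u_i`. -/
def gen {n : ℕ} (i : Fin (n - 1)) : NDiagram n where
  link := genLink i
  link_link := by
    rintro (⟨k, hk⟩ | ⟨k, hk⟩) <;> simp only [genLink] <;> split_ifs <;>
      simp_all
  link_ne := by
    rintro (⟨k, hk⟩ | ⟨k, hk⟩) <;> simp only [genLink] <;> split_ifs <;>
      simp_all
  planar := by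
    rintro (⟨j, hj⟩ | ⟨j, hj⟩) (⟨k, hk⟩ | ⟨k, hk⟩) <;> simp only [genLink] <;> split_ifs <;>
      simp only [boundaryPos] <;> omega

/-! ### Concatenation

The concatenation of `d` and `e` has three columns of points: left, middle, right. The right line of
`d` is identified with the left line of `e`. -/

/-- The inclusion of the points of the first diagram into the three columns. -/
def inFst {n : ℕ} : Fin n ⊕ Fin n → Fin n ⊕ Fin n ⊕ Fin n := Sum.map id Sum.inl

/-- The inclusion of the points of the second diagram into the three columns. -/
def inSnd {n : ℕ} : Fin n ⊕ Fin n → Fin n ⊕ Fin n ⊕ Fin n := Sum.inr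

/-- The inclusion of the points of the two outer columns into the three columns. -/
def outer {n : ℕ} : Fin n ⊕ Fin n → Fin n ⊕ Fin n ⊕ Fin n := Sum.map id Sum.inr

/-- The graph formed by the links of two concatenated diagrams. -/
def concat {n : ℕ} (d e : NDiagram n) : SimpleGraph (Fin n ⊕ Fin n ⊕ Fin n) where
  Adj v w := (∃ p, v = inFst p ∧ w = inFst (d.link p)) ∨ (∃ p, v = inSnd p ∧ w = inSnd (e.link p))
  symm := ⟨by
    rintro v w (⟨p, rfl, rfl⟩ | ⟨p, rfl, rfl⟩)
    · exact Or.inl ⟨d.link p, rfl, by rw [d.link_link]⟩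
    · exact Or.inr ⟨e.link p, rfl, by rw [e.link_link]⟩⟩
  loopless := ⟨by
    rintro v (⟨p, rfl, h⟩ | ⟨p, rfl, h⟩)
    · refine d.link_ne p (?_ : d.link p = p)
      have hinj : Function.Injective (inFst (n := n)) :=
        Sum.map_injective.2 ⟨Function.injective_id, Sum.inl_injective⟩
      exact (hinj h).symm
    · exact e.link_ne p (Sum.inr_injective h).symm⟩

/-- The number of interior loops of a concatenation: the number of connected components which
contain no point of the two outer columns. -/
noncomputable def loops {n : ℕ} (d e : NDiagram n) : ℕ :=
  Nat.card {c : (d.concat e).ConnectedComponent //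
    ∀ p, (d.concat e).connectedComponentMk (outer p) ≠ c}

lemma inFst_injective {n : ℕ} : Function.Injective (inFst (n := n)) :=
  Sum.map_injective.2 ⟨Function.injective_id, Sum.inl_injective⟩

lemma inSnd_injective {n : ℕ} : Function.Injective (inSnd (n := n)) := Sum.inr_injective

lemma outer_injective {n : ℕ} : Function.Injective (outer (n := n)) :=
  Sum.map_injective.2 ⟨Function.injective_id, Sum.inr_injective⟩

lemma adj_inFst {n : ℕ} (d e : NDiagram n) (p : Fin n ⊕ Fin n) :
    (d.concat e).Adj (inFst p) (inFst (d.link p)) := Or.inl ⟨p, rfl, rfl⟩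

lemma adj_inSnd {n : ℕ} (d e : NDiagram n) (p : Fin n ⊕ Fin n) :
    (d.concat e).Adj (inSnd p) (inSnd (e.link p)) := Or.inr ⟨p, rfl, rfl⟩

/-- A set of points closed under links has an even number of elements. -/
lemma sum_eq_zero {n : ℕ} (d : NDiagram n) (χ : Fin n ⊕ Fin n → ZMod 2)
    (h : ∀ p, χ (d.link p) = χ p) : ∑ p, χ p = 0 := by
  refine Finset.sum_involution (fun p _ => d.link p) ?_ ?_ ?_ ?_
  · intro p _; rw [h]; exact CharTwo.add_self_eq_zero _
  · intro p _ _; exact d.link_ne p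
  · intro p _; simp
  · intro p _; exact d.link_link p

lemma boundaryPos_injective {n : ℕ} : Function.Injective (boundaryPos (n := n)) := by
  rintro (⟨i, hi⟩ | ⟨i, hi⟩) (⟨j, hj⟩ | ⟨j, hj⟩) h <;> simp [boundaryPos] at h ⊢ <;> omega

/-- The number of elements of a set closed under links above the one end of a link outside the set
has the same parity as that above the other end. -/
lemma sum_below_eq {n : ℕ} (d : NDiagram n) (χ : Fin n ⊕ Fin n → ZMod 2)
    (h : ∀ p, χ (d.link p) = χ p) (p : Fin n ⊕ Fin n) (hp : χ p = 0) :
    (∑ s, if boundaryPos s < boundaryPos p then χ s else 0) =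
      ∑ s, if boundaryPos s < boundaryPos (d.link p) then χ s else 0 := by
  wlog hlt : boundaryPos p < boundaryPos (d.link p) generalizing p
  · have hne : boundaryPos p ≠ boundaryPos (d.link p) :=
      fun h' => d.link_ne p (boundaryPos_injective h').symm
    have := this (d.link p) (by rw [h, hp]) (by rw [d.link_link]; omega)
    rw [d.link_link] at this
    exact this.symm
  have key : ∀ s, boundaryPos p < boundaryPos s ∧ boundaryPos s < boundaryPos (d.link p) →
      boundaryPos p < boundaryPos (d.link s) ∧
        boundaryPos (d.link s) < boundaryPos (d.link p) := by
    rintro s ⟨h1, h2⟩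
    have a1 := d.planar p s
    have a2 := d.planar (d.link s) p
    rw [d.link_link] at a2
    have b1 : boundaryPos (d.link s) ≠ boundaryPos p := by
      intro h'
      have := boundaryPos_injective h'
      rw [← this, d.link_link] at h2
      omega
    have b2 : boundaryPos (d.link s) ≠ boundaryPos (d.link p) := by
      intro h'
      have := congrArg d.link (boundaryPos_injective h')
      rw [d.link_link, d.link_link] at this
      rw [this] at h1
      omega
    omega
  have key' : ∀ s, (boundaryPos p < boundaryPos (d.link s) ∧
        boundaryPos (d.link s) < boundaryPos (d.link p)) ↔
      (boundaryPos p < boundaryPos s ∧ boundaryPos s < boundaryPos (d.link p)) := by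
    intro s
    refine ⟨fun h' => ?_, key s⟩
    have := key _ h'
    rwa [d.link_link] at this
  have h0 := d.sum_eq_zero
    (fun s => if boundaryPos p < boundaryPos s ∧ boundaryPos s < boundaryPos (d.link p)
      then χ s else 0) (fun s => by simp only [key', h])
  have h1 : (∑ s, if boundaryPos s < boundaryPos (d.link p) then χ s else 0) =
      (∑ s, if boundaryPos s < boundaryPos p then χ s else 0) +
      ∑ s, if boundaryPos p < boundaryPos s ∧ boundaryPos s < boundaryPos (d.link p)
        then χ s else 0 := by
    rw [← Finset.sum_add_distrib]
    refine Finset.sum_congr rfl fun s _ => ?_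
    by_cases hs : s = p
    · subst hs; simp [hp]
    · have : boundaryPos s ≠ boundaryPos p := fun h' => hs (boundaryPos_injective h')
      split_ifs <;> first | (exfalso; omega) | simp
  rw [h1, h0, add_zero]

/-- The weight of the points strictly above a given point in its column. -/
def above {n : ℕ} (χ : Fin n ⊕ Fin n → ZMod 2) : Fin n ⊕ Fin n → ZMod 2
  | Sum.inl i => ∑ k, if k < i then χ (Sum.inl k) else 0
  | Sum.inr i => ∑ k, if k < i then χ (Sum.inr k) else 0

lemma sum_below_eq_above {n : ℕ} (χ : Fin n ⊕ Fin n → ZMod 2)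
    (h : ∑ p, χ p = 0) (p : Fin n ⊕ Fin n) (hp : χ p = 0) :
    (∑ s, if boundaryPos s < boundaryPos p then χ s else 0) = above χ p := by
  rw [Fintype.sum_sum_type] at h ⊢
  rcases p with i | j
  · have h2 : ∀ k : Fin n, ¬ (2 * n - 1 - (k : ℕ) < (i : ℕ)) := fun k => by omega
    simp [boundaryPos, above, h2]
  · have h1 : ∀ k : Fin n, ((k : ℕ) < 2 * n - 1 - (j : ℕ)) := fun k => by omega
    have h2 : ∀ k : Fin n, (2 * n - 1 - (k : ℕ) < 2 * n - 1 - (j : ℕ)) ↔ j < k :=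
      fun k => by omega
    simp only [boundaryPos, above, h1, h2, if_true]
    have h3 : ∑ k, χ (Sum.inr k) = (∑ k, if j < k then χ (Sum.inr k) else 0) +
        ∑ k, if k < j then χ (Sum.inr k) else 0 := by
      rw [← Finset.sum_add_distrib]
      refine Finset.sum_congr rfl fun k _ => ?_
      rcases lt_trichotomy k j with hk | hk | hk
      · simp [hk, hk.le]
      · subst hk; simp [hp]
      · simp [hk, hk.le]
    rw [h3, ← add_assoc] at h
    exact CharTwo.add_eq_zero.1 h

/-- The weight of the points strictly above a given point in its column, for three columns. -/
def above₃ {n : ℕ} (χ : Fin n ⊕ Fin n ⊕ Fin n → ZMod 2) : Fin n ⊕ Fin n ⊕ Fin n → ZMod 2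
  | Sum.inl i => ∑ k, if k < i then χ (Sum.inl k) else 0
  | Sum.inr (Sum.inl i) => ∑ k, if k < i then χ (Sum.inr (Sum.inl k)) else 0
  | Sum.inr (Sum.inr i) => ∑ k, if k < i then χ (Sum.inr (Sum.inr k)) else 0

lemma above_inFst {n : ℕ} (χ : Fin n ⊕ Fin n ⊕ Fin n → ZMod 2) (p : Fin n ⊕ Fin n) :
    above₃ χ (inFst p) = above (fun p => χ (inFst p)) p := by
  rcases p with i | i <;> rfl

lemma above_inSnd {n : ℕ} (χ : Fin n ⊕ Fin n ⊕ Fin n → ZMod 2) (p : Fin n ⊕ Fin n) :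
    above₃ χ (inSnd p) = above (fun p => χ (inSnd p)) p := by
  rcases p with i | i <;> rfl

lemma above_outer {n : ℕ} (χ : Fin n ⊕ Fin n ⊕ Fin n → ZMod 2) (p : Fin n ⊕ Fin n) :
    above₃ χ (outer p) = above (fun p => χ (outer p)) p := by
  rcases p with i | i <;> rfl

lemma above_eq_link {n : ℕ} (d : NDiagram n) (χ : Fin n ⊕ Fin n → ZMod 2)
    (h : ∀ p, χ (d.link p) = χ p) (p : Fin n ⊕ Fin n) (hp : χ p = 0) :
    above χ p = above χ (d.link p) := by
  have h0 := d.sum_eq_zero χ h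
  rw [← sum_below_eq_above χ h0 p hp, ← sum_below_eq_above χ h0 _ (by rw [h, hp])]
  exact d.sum_below_eq χ h p hp

lemma above_eq_of_reachable {n : ℕ} (d e : NDiagram n)
    (χ : Fin n ⊕ Fin n ⊕ Fin n → ZMod 2) (h : ∀ v w, (d.concat e).Adj v w → χ w = χ v)
    (v w : Fin n ⊕ Fin n ⊕ Fin n) (hvw : (d.concat e).Reachable v w) (hv : χ v = 0) :
    above₃ χ v = above₃ χ w := by
  obtain ⟨q⟩ := hvw
  induction q with
  | nil => rfl
  | cons hadj _ ih =>
    rw [← ih (by rw [h _ _ hadj, hv])]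
    rcases hadj with ⟨p, rfl, rfl⟩ | ⟨p, rfl, rfl⟩
    · rw [above_inFst, above_inFst]
      exact d.above_eq_link _ (fun p => h _ _ (adj_inFst d e p)) p hv
    · rw [above_inSnd, above_inSnd]
      exact e.above_eq_link _ (fun p => h _ _ (adj_inSnd d e p)) p hv

lemma sum_outer_eq_zero {n : ℕ} (d e : NDiagram n)
    (χ : Fin n ⊕ Fin n ⊕ Fin n → ZMod 2) (h : ∀ v w, (d.concat e).Adj v w → χ w = χ v) :
    ∑ p, χ (outer p) = 0 := by
  have h1 := d.sum_eq_zero (fun p => χ (inFst p)) (fun p => h _ _ (adj_inFst d e p))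
  have h2 := e.sum_eq_zero (fun p => χ (inSnd p)) (fun p => h _ _ (adj_inSnd d e p))
  rw [Fintype.sum_sum_type] at h1 h2 ⊢
  simp only [inFst, inSnd, outer, Sum.map_inl, Sum.map_inr, id] at h1 h2 ⊢
  rw [CharTwo.add_eq_zero] at h1 h2 ⊢
  exact h1.trans h2

lemma exists_partner {n : ℕ} (d e : NDiagram n) (p : Fin n ⊕ Fin n) :
    ∃ q, q ≠ p ∧ (d.concat e).Reachable (outer p) (outer q) := by
  classical
  by_contra! hne
  have h := sum_outer_eq_zero d e
    (fun v => if (d.concat e).Reachable (outer p) v then 1 else 0) (fun v w hvw => by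
      have : (d.concat e).Reachable (outer p) w ↔ (d.concat e).Reachable (outer p) v :=
        ⟨fun h => h.trans hvw.symm.reachable, fun h => h.trans hvw.reachable⟩
      simp only [this])
  rw [Finset.sum_eq_single p] at h
  · simp at h
  · intro q _ hq
    simp [hne q hq]
  · simp

open Classical in
lemma partner_unique {n : ℕ} (d e : NDiagram n) (p q r : Fin n ⊕ Fin n) (hq : q ≠ p) (hr : r ≠ p)
    (hpq : (d.concat e).Reachable (outer p) (outer q))
    (hpr : (d.concat e).Reachable (outer p) (outer r)) : q = r := by
  by_contra hqr
  let G := d.concat e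
  let C := G.connectedComponentMk (outer p)
  let H := C.toSimpleGraph
  have hconn : H.Connected := C.connected_toSimpleGraph
  have h1 := hconn.card_vert_le_card_edgeSet_add_one
  rw [Nat.card_eq_fintype_card, Nat.card_eq_fintype_card, ← SimpleGraph.edgeFinset_card] at h1
  have h2 := H.sum_degrees_eq_twice_card_edges
  have hS : ∀ (v : C) (S : Finset (Fin n ⊕ Fin n ⊕ Fin n)), (∀ w, G.Adj v.1 w → w ∈ S) →
      H.degree v ≤ S.card := by
    intro v S hS
    rw [← SimpleGraph.card_neighborFinset_eq_degree,
      ← Finset.card_image_of_injective _ Subtype.val_injective]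
    refine Finset.card_le_card fun w hw => ?_
    obtain ⟨x, hx, rfl⟩ := Finset.mem_image.1 hw
    rw [SimpleGraph.mem_neighborFinset] at hx
    exact hS _ hx
  have hdeg : ∀ v : C, H.degree v + (if ∃ s, outer s = v.1 then 1 else 0) ≤ 2 := by
    rintro ⟨v, hv⟩
    rcases v with i | j | k
    · have := hS ⟨_, hv⟩ {inFst (d.link (Sum.inl i))} (by
        rintro w (⟨x | x, h, rfl⟩ | ⟨x, h, rfl⟩) <;> simp [inFst, inSnd] at h ⊢
        subst h; rfl)
      rw [Finset.card_singleton] at this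
      split_ifs <;> omega
    · have := (hS ⟨_, hv⟩ {inFst (d.link (Sum.inr j)), inSnd (e.link (Sum.inl j))} (by
        rintro w (⟨x | x, h, rfl⟩ | ⟨x | x, h, rfl⟩) <;> simp [inFst, inSnd] at h ⊢ <;>
        subst h <;> simp)).trans Finset.card_le_two
      rw [if_neg]
      · omega
      · rintro ⟨s | s, h⟩ <;> simp [outer] at h
    · have := hS ⟨_, hv⟩ {inSnd (e.link (Sum.inr k))} (by
        rintro w (⟨x | x, h, rfl⟩ | ⟨x, h, rfl⟩) <;> simp [inFst, inSnd] at h ⊢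
        subst h; rfl)
      rw [Finset.card_singleton] at this
      split_ifs <;> omega
  have h3 := Finset.sum_le_sum (fun v (_ : v ∈ Finset.univ) => hdeg v)
  rw [Finset.sum_add_distrib, h2, ← Finset.card_filter, Finset.sum_const, Finset.card_univ,
    smul_eq_mul] at h3
  have hmem : ∀ s, G.Reachable (outer p) (outer s) → outer s ∈ C.supp := fun s hs =>
    SimpleGraph.ConnectedComponent.sound hs.symm
  have h4 : ({⟨outer p, hmem p (SimpleGraph.Reachable.refl _)⟩, ⟨outer q, hmem q hpq⟩,
      ⟨outer r, hmem r hpr⟩} : Finset C) ⊆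
        Finset.univ.filter (fun v : C => ∃ s, outer s = v.1) := by
    intro v hv
    simp only [Finset.mem_insert, Finset.mem_singleton] at hv
    rw [Finset.mem_filter]
    refine ⟨Finset.mem_univ _, ?_⟩
    rcases hv with rfl | rfl | rfl
    · exact ⟨p, rfl⟩
    · exact ⟨q, rfl⟩
    · exact ⟨r, rfl⟩
  have h5 := Finset.card_le_card h4
  have hc : ∀ s t : Fin n ⊕ Fin n, s ≠ t → outer s ≠ outer t := fun s t h h' => h (outer_injective h')
  rw [Finset.card_eq_three.2 ⟨_, _, _, ?_, ?_, ?_, rfl⟩] at h5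
  · omega
  · exact fun h => hc _ _ hq.symm (congrArg Subtype.val h)
  · exact fun h => hc _ _ hr.symm (congrArg Subtype.val h)
  · exact fun h => hc _ _ hqr (congrArg Subtype.val h)

/-- The other outer point in the connected component of a given outer point. -/
noncomputable def partner {n : ℕ} (d e : NDiagram n) (p : Fin n ⊕ Fin n) : Fin n ⊕ Fin n :=
  (exists_partner d e p).choose

lemma partner_ne {n : ℕ} (d e : NDiagram n) (p : Fin n ⊕ Fin n) : partner d e p ≠ p :=
  (exists_partner d e p).choose_spec.1

lemma reachable_partner {n : ℕ} (d e : NDiagram n) (p : Fin n ⊕ Fin n) :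
    (d.concat e).Reachable (outer p) (outer (partner d e p)) :=
  (exists_partner d e p).choose_spec.2

lemma eq_partner {n : ℕ} (d e : NDiagram n) (p q : Fin n ⊕ Fin n) (hq : q ≠ p)
    (h : (d.concat e).Reachable (outer p) (outer q)) : q = partner d e p :=
  partner_unique d e p _ _ hq (partner_ne d e p) h (reachable_partner d e p)

lemma partner_planar {n : ℕ} (d e : NDiagram n) (p q : Fin n ⊕ Fin n) :
    ¬ (boundaryPos p < boundaryPos q ∧ boundaryPos q < boundaryPos (partner d e p) ∧
      boundaryPos (partner d e p) < boundaryPos (partner d e q)) := by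
  classical
  rintro ⟨h1, h2, h3⟩
  let χ : Fin n ⊕ Fin n ⊕ Fin n → ZMod 2 :=
    fun v => if (d.concat e).Reachable (outer p) v then 1 else 0
  have hχ : ∀ v w, (d.concat e).Adj v w → χ w = χ v := fun v w hvw => by
    have : (d.concat e).Reachable (outer p) w ↔ (d.concat e).Reachable (outer p) v :=
      ⟨fun h => h.trans hvw.symm.reachable, fun h => h.trans hvw.reachable⟩
    simp only [χ, this]
  have hval : ∀ s, χ (outer s) = (if s = p then 1 else 0) + if s = partner d e p then 1 else 0 := by
    intro s
    by_cases hsp : s = p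
    · subst hsp
      simp [χ, (partner_ne d e s).symm]
    · have : (d.concat e).Reachable (outer p) (outer s) ↔ s = partner d e p :=
        ⟨eq_partner d e p s hsp, by rintro rfl; exact reachable_partner d e p⟩
      simp [χ, this, hsp]
  have hz : ∀ s, boundaryPos s ≠ boundaryPos p → boundaryPos s ≠ boundaryPos (partner d e p) →
      χ (outer s) = 0 := by
    intro s ha hb
    rw [hval, if_neg (fun h => ha (congrArg _ h)), if_neg (fun h => hb (congrArg _ h)), add_zero]
  have hz1 := hz q (by omega) (by omega)
  have hz2 := hz (partner d e q) (by omega) (by omega)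
  have key := above_eq_of_reachable d e χ hχ _ _ (reachable_partner d e q) hz1
  have h0 := sum_outer_eq_zero d e χ hχ
  rw [above_outer, above_outer,
    ← sum_below_eq_above (fun s => χ (outer s)) h0 _ hz1,
    ← sum_below_eq_above (fun s => χ (outer s)) h0 _ hz2] at key
  have hsum : ∀ t : Fin n ⊕ Fin n, (∑ s, if boundaryPos s < boundaryPos t then χ (outer s) else 0) =
      (if boundaryPos p < boundaryPos t then 1 else 0) +
        if boundaryPos (partner d e p) < boundaryPos t then 1 else 0 := by
    intro t
    rw [← Finset.sum_filter]
    simp only [hval, Finset.sum_add_distrib, Finset.sum_ite_eq', Finset.mem_filter,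
      Finset.mem_univ, true_and]
  rw [hsum, hsum, if_pos h1, if_neg (by omega), if_pos (by omega), if_pos h3] at key
  revert key
  decide

/-- The diagram obtained by concatenating two diagrams and removing the interior loops and the
middle line: two outer points are linked if they are connected in the concatenation. -/
noncomputable def comp {n : ℕ} (d e : NDiagram n) : NDiagram n where
  link := partner d e
  link_link p := (eq_partner d e _ _ (partner_ne d e p).symm (reachable_partner d e p).symm).symm
  link_ne := partner_ne d e
  planar := partner_planar d e

lemma comp_link_eq_iff {n : ℕ} (d e : NDiagram n) (p q : Fin n ⊕ Fin n) :
    (d.comp e).link p = q ↔ q ≠ p ∧ (d.concat e).Reachable (outer p) (outer q) := by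
  constructor
  · rintro rfl
    exact ⟨partner_ne d e p, reachable_partner d e p⟩
  · rintro ⟨h1, h2⟩
    exact (eq_partner d e p q h1 h2).symm

/-! ### Associativity of the concatenation

Both the composite and the number of loops are recovered from the matrices that record which
two-colourings of the marked points are constant on the links. -/

/-- A colouring of the marked points that is constant on every link. -/
def Compat {n : ℕ} (d : NDiagram n) (F : Fin n ⊕ Fin n → Bool) : Prop := ∀ p, F (d.link p) = F p

lemma colour_eq {n : ℕ} (d e : NDiagram n) (F : Fin n ⊕ Fin n ⊕ Fin n → Bool)
    (hd : ∀ p, F (inFst (d.link p)) = F (inFst p)) (he : ∀ p, F (inSnd (e.link p)) = F (inSnd p))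
    (v w : Fin n ⊕ Fin n ⊕ Fin n) (h : (d.concat e).Reachable v w) : F v = F w := by
  obtain ⟨q⟩ := h
  induction q with
  | nil => rfl
  | cons hadj _ ih =>
    rw [← ih]
    rcases hadj with ⟨p, rfl, rfl⟩ | ⟨p, rfl, rfl⟩
    · exact (hd p).symm
    · exact (he p).symm

lemma elim_inFst {n : ℕ} (f g h : Fin n → Bool) (p : Fin n ⊕ Fin n) :
    Sum.elim f (Sum.elim g h) (inFst p) = Sum.elim f g p := by rcases p with i | i <;> rfl

lemma elim_inSnd {n : ℕ} (f g h : Fin n → Bool) (p : Fin n ⊕ Fin n) :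
    Sum.elim f (Sum.elim g h) (inSnd p) = Sum.elim g h p := by rcases p with i | i <;> rfl

lemma elim_outer {n : ℕ} (f g h : Fin n → Bool) (p : Fin n ⊕ Fin n) :
    Sum.elim f (Sum.elim g h) (outer p) = Sum.elim f h p := by rcases p with i | i <;> rfl

lemma colour_eq' {n : ℕ} (d e : NDiagram n) (f g h : Fin n → Bool)
    (hd : d.Compat (Sum.elim f g)) (he : e.Compat (Sum.elim g h))
    (v w : Fin n ⊕ Fin n ⊕ Fin n) (hvw : (d.concat e).Reachable v w) :
    Sum.elim f (Sum.elim g h) v = Sum.elim f (Sum.elim g h) w := by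
  refine colour_eq d e _ (fun p => ?_) (fun p => ?_) v w hvw
  · rw [elim_inFst, elim_inFst, hd]
  · rw [elim_inSnd, elim_inSnd, he]

open Classical in
lemma card_colourings {n : ℕ} (d e : NDiagram n) (f h : Fin n → Bool) :
    Nat.card {g : Fin n → Bool // d.Compat (Sum.elim f g) ∧ e.Compat (Sum.elim g h)} =
      if (d.comp e).Compat (Sum.elim f h) then 2 ^ loops d e else 0 := by
  split_ifs with hc
  · let G := d.concat e
    let L := {c : G.ConnectedComponent // ∀ p, G.connectedComponentMk (outer p) ≠ c}
    have hL : Nat.card (L → Bool) = 2 ^ loops d e := by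
      rw [Nat.card_fun]; simp [loops, L, G]
    rw [← hL]
    let E : (L → Bool) → G.ConnectedComponent → Bool := fun φ c =>
      if hp : ∃ p, G.connectedComponentMk (outer p) = c then Sum.elim f h hp.choose
      else φ ⟨c, not_exists.1 hp⟩
    have hE1 : ∀ φ p, E φ (G.connectedComponentMk (outer p)) = Sum.elim f h p := by
      intro φ p
      have hp : ∃ p', G.connectedComponentMk (outer p') = G.connectedComponentMk (outer p) :=
        ⟨p, rfl⟩
      have h1 : E φ (G.connectedComponentMk (outer p)) = Sum.elim f h hp.choose := dif_pos hp
      rw [h1]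
      by_cases hpp : hp.choose = p
      · rw [hpp]
      · have h2 := (comp_link_eq_iff d e p hp.choose).2
          ⟨hpp, (SimpleGraph.ConnectedComponent.exact hp.choose_spec).symm⟩
        rw [← h2, hc p]
    have hE2 : ∀ φ (c : L), E φ c.1 = φ c := fun φ c => by
      have hp : ¬ ∃ p, G.connectedComponentMk (outer p) = c.1 := not_exists.2 c.2
      exact dif_neg hp
    have hE3 : ∀ φ v, Sum.elim f (Sum.elim
        (fun j => E φ (G.connectedComponentMk (Sum.inr (Sum.inl j)))) h) v =
        E φ (G.connectedComponentMk v) := by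
      rintro φ (i | j | k)
      · exact (hE1 φ (Sum.inl i)).symm
      · rfl
      · exact (hE1 φ (Sum.inr k)).symm
    let Φ : (L → Bool) →
        {g : Fin n → Bool // d.Compat (Sum.elim f g) ∧ e.Compat (Sum.elim g h)} := fun φ =>
      ⟨fun j => E φ (G.connectedComponentMk (Sum.inr (Sum.inl j))), by
        constructor
        · intro p
          rw [← elim_inFst _ _ h, ← elim_inFst _ _ h, hE3, hE3]
          exact congrArg _ (SimpleGraph.ConnectedComponent.sound (adj_inFst d e p).symm.reachable)
        · intro p
          rw [← elim_inSnd f, ← elim_inSnd f, hE3, hE3]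
          exact congrArg _
            (SimpleGraph.ConnectedComponent.sound (adj_inSnd d e p).symm.reachable)⟩
    refine (Nat.card_eq_of_bijective Φ ⟨?_, ?_⟩).symm
    · intro φ ψ hφψ
      funext c
      obtain ⟨c, hcL⟩ := c
      induction c using SimpleGraph.ConnectedComponent.ind with | _ v => ?_
      rcases v with i | j | k
      · exact absurd rfl (hcL (Sum.inl i))
      · rw [← hE2 φ, ← hE2 ψ]
        exact congrFun (congrArg Subtype.val hφψ) j
      · exact absurd rfl (hcL (Sum.inr k))
    · rintro ⟨g, hd, he⟩
      have hF := colour_eq' d e f g h hd he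
      have hrep : ∀ c : G.ConnectedComponent, ∃ v, G.connectedComponentMk v = c :=
        fun c => c.exists_rep
      choose rep hrep using hrep
      let φ : L → Bool := fun c => Sum.elim f (Sum.elim g h) (rep c.1)
      refine ⟨φ, Subtype.ext (funext fun j => ?_)⟩
      have goal : E φ (G.connectedComponentMk (Sum.inr (Sum.inl j))) = g j := by
        by_cases hp : ∃ p, G.connectedComponentMk (outer p) =
            G.connectedComponentMk (Sum.inr (Sum.inl j))
        · obtain ⟨p, hp⟩ := hp
          rw [← hp, hE1, ← elim_outer f g h]
          exact hF _ (Sum.inr (Sum.inl j)) (SimpleGraph.ConnectedComponent.exact hp)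
        · refine (hE2 φ ⟨_, not_exists.1 hp⟩).trans ?_
          exact hF _ (Sum.inr (Sum.inl j)) (SimpleGraph.ConnectedComponent.exact (hrep _))
      exact goal
  · rw [Nat.card_eq_zero]
    left
    refine ⟨fun ⟨g, hd, he⟩ => hc fun p => ?_⟩
    rw [← elim_outer f g h, ← elim_outer f g h]
    exact (colour_eq' d e f g h hd he _ _ (reachable_partner d e p)).symm

open Classical in
/-- The matrix recording the two-colourings which are constant on the links. -/
noncomputable def colourMatrix {n : ℕ} (d : NDiagram n) :
    Matrix (Fin n → Bool) (Fin n → Bool) ℕ :=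
  fun f g => if d.Compat (Sum.elim f g) then 1 else 0

lemma colourMatrix_mul {n : ℕ} (d e : NDiagram n) :
    d.colourMatrix * e.colourMatrix = 2 ^ loops d e • (d.comp e).colourMatrix := by
  classical
  ext f h
  rw [Matrix.mul_apply, Matrix.smul_apply]
  have := card_colourings d e f h
  rw [Nat.card_eq_fintype_card, Fintype.card_subtype, Finset.card_filter] at this
  simp only [colourMatrix, smul_eq_mul, mul_ite, mul_one, mul_zero]
  rw [← this]
  refine Finset.sum_congr rfl fun g _ => ?_
  by_cases h1 : d.Compat (Sum.elim f g) <;> by_cases h2 : e.Compat (Sum.elim g h) <;>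
    simp [h1, h2]

lemma colourMatrix_one {n : ℕ} : (NDiagram.one n).colourMatrix = 1 := by
  classical
  ext f g
  rw [colourMatrix, Matrix.one_apply]
  refine if_congr ⟨fun h => funext fun i => ?_, ?_⟩ rfl rfl
  · exact h (Sum.inr i)
  · rintro rfl (i | i) <;> rfl

lemma eq_of_colourMatrix {n : ℕ} (d e : NDiagram n) (a b : ℕ)
    (h : 2 ^ a • d.colourMatrix = 2 ^ b • e.colourMatrix) : d = e ∧ a = b := by
  classical
  have hent : ∀ F : Fin n ⊕ Fin n → Bool,
      (2 ^ a * if d.Compat F then 1 else 0) = 2 ^ b * if e.Compat F then 1 else 0 := by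
    intro F
    have := congrFun (congrFun h (F ∘ Sum.inl)) (F ∘ Sum.inr)
    simpa only [Matrix.smul_apply, colourMatrix, smul_eq_mul, Sum.elim_comp_inl_inr] using this
  constructor
  · refine NDiagram.ext (funext fun p => ?_)
    let F : Fin n ⊕ Fin n → Bool := fun q => decide (q = p ∨ q = d.link p)
    have hF : d.Compat F := by
      intro q
      have h1 : d.link q = p ↔ q = d.link p :=
        ⟨fun h => by rw [← h, d.link_link], fun h => by rw [h, d.link_link]⟩
      have h2 : d.link q = d.link p ↔ q = p :=
        ⟨fun h => by rw [← d.link_link q, h, d.link_link], fun h => by rw [h]⟩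
      simp only [F, h1, h2, or_comm]
    have h1 := hent F
    rw [if_pos hF] at h1
    have hF' : e.Compat F := by
      by_contra hne
      rw [if_neg hne] at h1
      simp at h1
    have h2 := hF' p
    simp only [F, true_or, decide_true, decide_eq_true_eq] at h2
    exact (h2.resolve_left (e.link_ne p)).symm
  · have h1 := hent (fun _ => true)
    have h2 : ∀ d : NDiagram n, d.Compat (fun _ => true) := fun _ _ => rfl
    rw [if_pos (h2 d), if_pos (h2 e), mul_one, mul_one] at h1
    exact Nat.pow_right_injective le_rfl h1

lemma comp_assoc {n : ℕ} (d e f : NDiagram n) :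
    (d.comp e).comp f = d.comp (e.comp f) ∧
      loops d e + loops (d.comp e) f = loops d (e.comp f) + loops e f := by
  refine eq_of_colourMatrix _ _ _ _ ?_
  have h1 : d.colourMatrix * e.colourMatrix * f.colourMatrix =
      2 ^ (loops d e + loops (d.comp e) f) • ((d.comp e).comp f).colourMatrix := by
    rw [colourMatrix_mul, Matrix.smul_mul, colourMatrix_mul, smul_smul, pow_add]
  have h2 : d.colourMatrix * (e.colourMatrix * f.colourMatrix) =
      2 ^ (loops d (e.comp f) + loops e f) • (d.comp (e.comp f)).colourMatrix := by
    rw [colourMatrix_mul, Matrix.mul_smul, colourMatrix_mul, smul_smul, pow_add, mul_comm]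
  rw [← h1, ← h2, Matrix.mul_assoc]

lemma one_comp {n : ℕ} (d : NDiagram n) :
    (NDiagram.one n).comp d = d ∧ loops (NDiagram.one n) d = 0 := by
  refine eq_of_colourMatrix _ _ _ _ ?_
  rw [← colourMatrix_mul, colourMatrix_one, one_mul, pow_zero, one_smul]

lemma comp_one {n : ℕ} (d : NDiagram n) :
    d.comp (NDiagram.one n) = d ∧ loops d (NDiagram.one n) = 0 := by
  refine eq_of_colourMatrix _ _ _ _ ?_
  rw [← colourMatrix_mul, colourMatrix_one, mul_one, pow_zero, one_smul]

end NDiagram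

/-! ## The diagram algebra -/

/-- The `n`-diagram algebra with loop weight `β`: the complex vector space with the `n`-diagrams as
a basis; its multiplication is given below. -/
def NDiagramAlgebra (n : ℕ) (_β : ℂ) : Type := NDiagram n →₀ ℂ

namespace NDiagramAlgebra

noncomputable instance (n : ℕ) (β : ℂ) : AddCommGroup (NDiagramAlgebra n β) :=
  inferInstanceAs (AddCommGroup (NDiagram n →₀ ℂ))

noncomputable instance (n : ℕ) (β : ℂ) : Module ℂ (NDiagramAlgebra n β) :=
  inferInstanceAs (Module ℂ (NDiagram n →₀ ℂ))

/-- A diagram with a coefficient, as an element of the diagram algebra. -/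
noncomputable def single {n : ℕ} {β : ℂ} (d : NDiagram n) (x : ℂ) : NDiagramAlgebra n β :=
  Finsupp.single d x

/-- A diagram as an element of the diagram algebra. -/
noncomputable def ofDiagram {n : ℕ} (β : ℂ) (d : NDiagram n) : NDiagramAlgebra n β := single d 1

noncomputable instance (n : ℕ) (β : ℂ) : One (NDiagramAlgebra n β) := ⟨ofDiagram β (NDiagram.one n)⟩

/-- The bilinear extension of `d * e = β ^ loops d e • comp d e`. -/
noncomputable instance (n : ℕ) (β : ℂ) : Mul (NDiagramAlgebra n β) :=
  ⟨fun a b => Finsupp.sum (M := ℂ) a fun d x => Finsupp.sum (M := ℂ) b fun e y =>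
    single (d.comp e) (x * y * β ^ NDiagram.loops d e)⟩

lemma single_add {n : ℕ} {β : ℂ} (d : NDiagram n) (x y : ℂ) :
    (single d (x + y) : NDiagramAlgebra n β) = single d x + single d y := Finsupp.single_add d x y

lemma single_zero {n : ℕ} {β : ℂ} (d : NDiagram n) : (single d 0 : NDiagramAlgebra n β) = 0 :=
  Finsupp.single_zero d

lemma smul_single {n : ℕ} {β : ℂ} (d : NDiagram n) (c x : ℂ) :
    c • (single d x : NDiagramAlgebra n β) = single d (c * x) := Finsupp.smul_single c d x

lemma induction {n : ℕ} {β : ℂ} {P : NDiagramAlgebra n β → Prop} (a : NDiagramAlgebra n β)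
    (h0 : P 0) (hadd : ∀ a b, P a → P b → P (a + b)) (hs : ∀ d x, P (single d x)) : P a :=
  Finsupp.induction_linear a h0 hadd hs

lemma add_mul' {n : ℕ} {β : ℂ} (a b c : NDiagramAlgebra n β) : (a + b) * c = a * c + b * c := by
  classical
  refine Finsupp.sum_add_index' (M := ℂ) (f := a) (g := b) (fun d => ?_) (fun d x y => ?_)
  · simp only [zero_mul, single_zero]
    exact Finsupp.sum_fun_zero (M := ℂ) c
  · simp only [add_mul, single_add]
    exact Finsupp.sum_add

lemma mul_add' {n : ℕ} {β : ℂ} (a b c : NDiagramAlgebra n β) : a * (b + c) = a * b + a * c := by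
  classical
  refine Eq.trans (Finsupp.sum_congr fun d _ => ?_) (Finsupp.sum_add (M := ℂ) (f := a))
  refine Finsupp.sum_add_index' (M := ℂ) (f := b) (g := c) (fun e => ?_) (fun e x y => ?_)
  · simp [single_zero]
  · simp only [add_mul, mul_add, single_add]

lemma zero_mul' {n : ℕ} {β : ℂ} (a : NDiagramAlgebra n β) : 0 * a = 0 :=
  Finsupp.sum_zero_index (M := ℂ)

lemma mul_zero' {n : ℕ} {β : ℂ} (a : NDiagramAlgebra n β) : a * 0 = 0 := by
  have h := mul_add' a 0 0
  rw [add_zero] at h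
  exact left_eq_add.1 h

lemma single_mul_single {n : ℕ} {β : ℂ} (d e : NDiagram n) (x y : ℂ) :
    (single d x * single e y : NDiagramAlgebra n β) =
      single (d.comp e) (x * y * β ^ NDiagram.loops d e) := by
  refine (Finsupp.sum_single_index (M := ℂ) ?_).trans (Finsupp.sum_single_index (M := ℂ) ?_)
  · simp only [zero_mul, single_zero]
    exact Finsupp.sum_fun_zero (M := ℂ) (Finsupp.single e y)
  · simp [single_zero]

lemma mul_assoc' {n : ℕ} {β : ℂ} (a b c : NDiagramAlgebra n β) : a * b * c = a * (b * c) := by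
  induction a using induction with
  | h0 => simp only [zero_mul']
  | hadd a a' h h' => simp only [add_mul', h, h']
  | hs d x =>
  induction b using induction with
  | h0 => simp only [zero_mul', mul_zero']
  | hadd a a' h h' => simp only [add_mul', mul_add', h, h']
  | hs e y =>
  induction c using induction with
  | h0 => simp only [mul_zero']
  | hadd a a' h h' => simp only [mul_add', h, h']
  | hs f z =>
  obtain ⟨h1, h2⟩ := NDiagram.comp_assoc d e f
  simp only [single_mul_single, h1]
  congr 1
  have h3 := congrArg (fun m => x * y * z * β ^ m) h2
  simp only [pow_add] at h3
  linear_combination h3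

lemma one_mul' {n : ℕ} {β : ℂ} (a : NDiagramAlgebra n β) : 1 * a = a := by
  induction a using induction with
  | h0 => exact mul_zero' 1
  | hadd a a' h h' => rw [mul_add', h, h']
  | hs d x =>
  obtain ⟨h1, h2⟩ := NDiagram.one_comp d
  refine (single_mul_single (NDiagram.one n) d 1 x).trans ?_
  rw [h1, h2, pow_zero, mul_one, one_mul]

lemma mul_one' {n : ℕ} {β : ℂ} (a : NDiagramAlgebra n β) : a * 1 = a := by
  induction a using induction with
  | h0 => exact zero_mul' 1
  | hadd a a' h h' => rw [add_mul', h, h']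
  | hs d x =>
  obtain ⟨h1, h2⟩ := NDiagram.comp_one d
  refine (single_mul_single d (NDiagram.one n) x 1).trans ?_
  rw [h1, h2, pow_zero, mul_one, mul_one]

lemma smul_mul' {n : ℕ} {β : ℂ} (r : ℂ) (a b : NDiagramAlgebra n β) : r • a * b = r • (a * b) := by
  induction a using induction with
  | h0 => simp only [smul_zero, zero_mul']
  | hadd a a' h h' => simp only [smul_add, add_mul', h, h']
  | hs d x =>
  induction b using induction with
  | h0 => simp only [smul_zero, mul_zero']
  | hadd a a' h h' => simp only [smul_add, mul_add', h, h']
  | hs e y => simp only [smul_single, single_mul_single, mul_assoc]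

lemma mul_smul' {n : ℕ} {β : ℂ} (r : ℂ) (a b : NDiagramAlgebra n β) : a * r • b = r • (a * b) := by
  induction a using induction with
  | h0 => simp only [smul_zero, zero_mul']
  | hadd a a' h h' => simp only [smul_add, add_mul', h, h']
  | hs d x =>
  induction b using induction with
  | h0 => simp only [smul_zero, mul_zero']
  | hadd a a' h h' => simp only [smul_add, mul_add', h, h']
  | hs e y => simp only [smul_single, single_mul_single]; congr 1; ring

noncomputable instance (n : ℕ) (β : ℂ) : Ring (NDiagramAlgebra n β) :=
  { (inferInstance : AddCommGroup (NDiagramAlgebra n β)),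
    (inferInstance : Mul (NDiagramAlgebra n β)),
    (inferInstance : One (NDiagramAlgebra n β)) with
    left_distrib := mul_add'
    right_distrib := add_mul'
    zero_mul := zero_mul'
    mul_zero := mul_zero'
    mul_assoc := mul_assoc'
    one_mul := one_mul'
    mul_one := mul_one' }

noncomputable instance (n : ℕ) (β : ℂ) : Algebra ℂ (NDiagramAlgebra n β) :=
  Algebra.ofModule smul_mul' mul_smul'

end NDiagramAlgebra

/-! The proof compares dimensions and closes a cycle of inequalities. The diagrams `gen i` satisfy
the defining relations, which gives the homomorphism `TemperleyLieb.toDiagram`, and it is surjective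
because every diagram is a product of generators. So the number of diagrams is at most the dimension
of the abstract algebra. That dimension is at most `catalan n`, since the relations alone yield a
spanning set of that size. Finally, `catalan n` is at most the number of diagrams, since binary
trees with `n` nodes inject into them. All three numbers agree, and a surjection between spaces of
equal finite dimension is bijective. No linear independence of words is needed, and neither is an
exact count of diagrams.

Upper bound (`TLFamily.exists_spanning`): a word needs its generator of least index at most once
(`TLFamily.sandwich`). Filtering the algebra by the left ideals generated by the last generators
then gives the recursion of the Catalan triangle.

Relations of diagrams: `colourMatrix` determines a diagram together with its power of two, so an
identity of matrices yields both the composite and the loop count, hence the relation for every `β`.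

Surjectivity (`NDiagramAlgebra.ofDiagram_mem_adjoin_of_trivialFrom`): a diagram without a link
between adjacent right points is the identity. Otherwise such a link is moved down by generators to
the end of the nontrivial part, where one generator splits off and leaves a diagram with one more
straight strand (`bend`). -/

/-! ## Spanning sets of algebras generated by Temperley–Lieb families -/

/-- Elements `u 0, …, u (N - 1)` of an algebra which satisfy the Temperley–Lieb relations. -/
structure TLFamily {A : Type*} [Ring A] [Algebra ℂ A] (β : ℂ) (N : ℕ) (u : ℕ → A) : Prop where
  sq : ∀ i < N, u i * u i = β • u i
  up : ∀ i, i + 1 < N → u i * u (i + 1) * u i = u i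
  down : ∀ i, i + 1 < N → u (i + 1) * u i * u (i + 1) = u (i + 1)
  comm : ∀ i j, i + 2 ≤ j → j < N → u i * u j = u j * u i

namespace TLFamily

variable {A : Type*} [Ring A] [Algebra ℂ A] {β : ℂ} {N : ℕ} {u : ℕ → A}

/-- The subalgebra generated by `u a, …, u (N - 1)`. -/
def tail (N : ℕ) (u : ℕ → A) (a : ℕ) : Subalgebra ℂ A := Algebra.adjoin ℂ (u '' Set.Ico a N)

lemma mem_tail {a k : ℕ} (hak : a ≤ k) (hk : k < N) : u k ∈ tail N u a :=
  Algebra.subset_adjoin ⟨k, ⟨hak, hk⟩, rfl⟩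

lemma tail_anti {a b : ℕ} (h : a ≤ b) : tail N u b ≤ tail N u a :=
  Algebra.adjoin_mono (Set.image_mono (Set.Ico_subset_Ico_left h))

lemma tail_eq_bot {a : ℕ} (h : N ≤ a) : tail N u a = ⊥ := by
  rw [tail, Set.Ico_eq_empty (by omega), Set.image_empty, Algebra.adjoin_empty]

/-- A subspace stable under left multiplication by the generators of `tail a` is a left module
over `tail a`. -/
lemma tail_mul_mem {a : ℕ} (W : Submodule ℂ A)
    (hW : ∀ k, a ≤ k → k < N → ∀ w ∈ W, u k * w ∈ W) {x w : A} (hx : x ∈ tail N u a)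
    (hw : w ∈ W) : x * w ∈ W := by
  revert w
  induction hx using Algebra.adjoin_induction with
  | mem x hx =>
    obtain ⟨k, ⟨h1, h2⟩, rfl⟩ := hx
    exact fun {w} hw => hW k h1 h2 w hw
  | algebraMap r =>
    intro w hw
    rw [← Algebra.smul_def]
    exact W.smul_mem r hw
  | add x y _ _ hx hy =>
    intro w hw
    rw [add_mul]
    exact W.add_mem (hx hw) (hy hw)
  | mul x y _ _ hx hy =>
    intro w hw
    rw [mul_assoc]
    exact hx (hy hw)

lemma mul_tail_comm (hu : TLFamily β N u) {a : ℕ} {x : A} (hx : x ∈ tail N u (a + 2)) :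
    u a * x = x * u a := by
  have h : tail N u (a + 2) ≤ Subalgebra.centralizer ℂ {u a} := by
    refine Algebra.adjoin_le ?_
    rintro _ ⟨k, ⟨h1, h2⟩, rfl⟩
    rw [SetLike.mem_coe, Subalgebra.mem_centralizer_iff]
    rintro _ rfl
    exact hu.comm a k h1 h2
  exact (Subalgebra.mem_centralizer_iff ℂ).1 (h hx) _ rfl

/-! ### Reduction to one factor of least index -/

/-- The products with at most one factor `u a` and all other factors in `tail (a + 1)`. -/
def thin (N : ℕ) (u : ℕ → A) (a : ℕ) : Submodule ℂ A :=
  (tail N u (a + 1)).toSubmodule ⊔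
    Submodule.span ℂ {x | ∃ y ∈ tail N u (a + 1), ∃ z ∈ tail N u (a + 1), x = y * u a * z}

/-- The subspace `tail b * x`. -/
def tailMul (N : ℕ) (u : ℕ → A) (b : ℕ) (x : A) : Submodule ℂ A :=
  (tail N u b).toSubmodule.map (LinearMap.mulRight ℂ x)

lemma mem_tailMul {b : ℕ} {x y : A} :
    y ∈ tailMul N u b x ↔ ∃ z ∈ tail N u b, z * x = y := by
  simp [tailMul]

/-- It suffices to treat `z` with at most one factor `u (a + 1)`. What lies in `tail (a + 2)`
commutes with `u a`, so either `u a * u a` or `u a * u (a + 1) * u a` is left in the middle, and a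
relation shortens it. -/
lemma sandwich_of_thin (hu : TLFamily β N u) {a : ℕ} (ha : a + 1 < N)
    (h : (tail N u (a + 1)).toSubmodule ≤ thin N u (a + 1)) {z : A} (hz : z ∈ tail N u (a + 1)) :
    u a * z * u a ∈ tailMul N u (a + 1) (u a) := by
  let L : A →ₗ[ℂ] A := LinearMap.mulRight ℂ (u a) ∘ₗ LinearMap.mulLeft ℂ (u a)
  suffices thin N u (a + 1) ≤ (tailMul N u (a + 1) (u a)).comap L from this (h hz)
  refine sup_le ?_ (Submodule.span_le.2 ?_)
  · intro y hy
    have hy' : y ∈ tail N u (a + 2) := hy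
    refine mem_tailMul.2 ⟨β • y, Subalgebra.smul_mem _ (tail_anti (Nat.le_succ _) hy') _, ?_⟩
    simp only [L, LinearMap.comp_apply, LinearMap.mulLeft_apply, LinearMap.mulRight_apply]
    rw [hu.mul_tail_comm hy', mul_assoc, hu.sq a (by omega), mul_smul_comm, smul_mul_assoc]
  · rintro _ ⟨y, hy, z, hz, rfl⟩
    refine mem_tailMul.2 ⟨y * z, mul_mem (tail_anti (Nat.le_succ _) hy)
      (tail_anti (Nat.le_succ _) hz), ?_⟩
    simp only [L, LinearMap.comp_apply, LinearMap.mulLeft_apply, LinearMap.mulRight_apply]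
    calc y * z * u a = y * (u a * u (a + 1) * u a) * z := by
          rw [hu.up a ha, mul_assoc, mul_assoc, hu.mul_tail_comm hz]
      _ = (y * u a) * u (a + 1) * (u a * z) := by simp only [mul_assoc]
      _ = u a * (y * u (a + 1) * z) * u a := by
          rw [hu.mul_tail_comm hz, ← hu.mul_tail_comm hy]; simp only [mul_assoc]

/-- A new `u a` on the left meets at most one old `u a`, and the hypothesis merges the two. Any
other generator is absorbed by the left factor. -/
lemma thin_of_sandwich {a : ℕ}
    (h : ∀ z ∈ tail N u (a + 1), u a * z * u a ∈ tailMul N u (a + 1) (u a)) :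
    (tail N u a).toSubmodule ≤ thin N u a := by
  intro x hx
  -- Since `1` is thin, it is enough that `thin N u a` is stable under left multiplication by the
  -- generators.
  rw [← mul_one x]
  refine tail_mul_mem (thin N u a) ?_ hx (Submodule.mem_sup_left (one_mem (tail N u (a + 1))))
  intro k hak hk w hw
  suffices thin N u a ≤ (thin N u a).comap (LinearMap.mulLeft ℂ (u k)) from this hw
  rcases hak.eq_or_lt with rfl | hak
  · refine sup_le ?_ (Submodule.span_le.2 ?_)
    · intro y hy
      exact Submodule.mem_sup_right (Submodule.subset_span ⟨1, one_mem _, y, hy, by simp⟩)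
    · rintro _ ⟨y, hy, z, hz, rfl⟩
      obtain ⟨y', hy', h'⟩ := mem_tailMul.1 (h y hy)
      refine Submodule.mem_sup_right (Submodule.subset_span ⟨y', hy', z, hz, ?_⟩)
      rw [h', LinearMap.mulLeft_apply]
      simp only [mul_assoc]
  · have hk' : u k ∈ tail N u (a + 1) := mem_tail hak hk
    refine sup_le ?_ (Submodule.span_le.2 ?_)
    · intro y hy
      exact Submodule.mem_sup_left ((tail N u (a + 1)).mul_mem hk' hy)
    · rintro _ ⟨y, hy, z, hz, rfl⟩
      refine Submodule.mem_sup_right (Submodule.subset_span ⟨u k * y, mul_mem hk' hy, z, hz, ?_⟩)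
      simp only [LinearMap.mulLeft_apply, mul_assoc]

/-- The two preceding implications alternate in a descending induction on `a`, which starts at the
last generator, where `z` is a scalar. -/
lemma sandwich (hu : TLFamily β N u) {a : ℕ} (ha : a < N) {z : A} (hz : z ∈ tail N u (a + 1)) :
    u a * z * u a ∈ tailMul N u (a + 1) (u a) := by
  obtain ⟨m, hm⟩ : ∃ m, a + 1 + m = N := ⟨N - (a + 1), by omega⟩
  induction m generalizing a z with
  | zero =>
    rw [tail_eq_bot (by omega)] at hz
    obtain ⟨r, rfl⟩ := Algebra.mem_bot.1 hz
    refine mem_tailMul.2 ⟨algebraMap ℂ A (r * β), Subalgebra.algebraMap_mem _ _, ?_⟩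
    rw [← Algebra.commutes, mul_assoc, hu.sq a ha, ← Algebra.smul_def, ← Algebra.smul_def,
      smul_smul]
  | succ m ih =>
    exact hu.sandwich_of_thin (by omega)
      (thin_of_sandwich fun z hz => ih (by omega) hz (by omega)) hz

/-- Every element of `tail a * u a` lies in `tail (a + 1) * u a`. -/
lemma tail_mul_gen (hu : TLFamily β N u) {a : ℕ} (ha : a < N) {x : A} (hx : x ∈ tail N u a) :
    x * u a ∈ tailMul N u (a + 1) (u a) := by
  refine tail_mul_mem _ ?_ hx (mem_tailMul.2 ⟨1, one_mem _, one_mul _⟩)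
  intro k hak hk w hw
  obtain ⟨y, hy, rfl⟩ := mem_tailMul.1 hw
  rcases hak.eq_or_lt with rfl | hak
  · rw [← mul_assoc]
    exact hu.sandwich ha hy
  · exact mem_tailMul.2 ⟨u k * y, mul_mem (mem_tail hak hk) hy, mul_assoc _ _ _⟩

/-! ### Counting by the Catalan triangle -/

/-- The product `u a * u (a + 1) * ⋯ * u (a + J)`. -/
def run (u : ℕ → A) (a : ℕ) : ℕ → A
  | 0 => u a
  | J + 1 => run u a J * u (a + (J + 1))

lemma run_mem {a J : ℕ} (h : a + J < N) : run u a J ∈ tail N u a := by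
  induction J with
  | zero => exact mem_tail le_rfl h
  | succ J ih => exact mul_mem (ih (by omega)) (mem_tail (by omega) h)

/-- Together with the fact that `run u a J` ends in `u (a + J)`, this shows that both generate the
same left ideal of `tail a`. The relation `down` inserts the missing factors one at a time. -/
lemma gen_eq_mul_run (hu : TLFamily β N u) {a J : ℕ} (h : a + J < N) :
    ∃ x ∈ tail N u a, u (a + J) = x * run u a J := by
  induction J with
  | zero => exact ⟨1, one_mem _, (one_mul _).symm⟩
  | succ J ih =>
    obtain ⟨x, hx, hJ⟩ := ih (by omega)
    refine ⟨u (a + (J + 1)) * x, mul_mem (mem_tail (by omega) h) hx, ?_⟩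
    rw [run, mul_assoc, ← mul_assoc x, ← hJ, ← mul_assoc]
    exact (hu.down (a + J) h).symm

lemma run_eq_gen_mul (a J : ℕ) (h : a + J < N) :
    ∃ y ∈ tail N u (a + 1), run u a J = u a * y := by
  induction J with
  | zero => exact ⟨1, one_mem _, (mul_one _).symm⟩
  | succ J ih =>
    obtain ⟨y, hy, hJ⟩ := ih (by omega)
    exact ⟨y * u (a + (J + 1)), mul_mem hy (mem_tail (by omega) h), by rw [run, hJ, mul_assoc]⟩

/-- Once `u (a + J)` is replaced by a multiple of the run, which begins with `u a`, the factors `u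
a` to the left of the run can be absorbed by `tail_mul_gen`. -/
lemma tail_mul_gen_add (hu : TLFamily β N u) {a J : ℕ} (h : a + J < N) {x : A}
    (hx : x ∈ tail N u a) : x * u (a + J) ∈ tailMul N u (a + 1) (run u a J) := by
  obtain ⟨y, hy, h1⟩ := hu.gen_eq_mul_run h
  obtain ⟨z, hz, h2⟩ := run_eq_gen_mul (u := u) a J h
  obtain ⟨w, hw, h3⟩ := mem_tailMul.1 (hu.tail_mul_gen (by omega) (mul_mem hx hy))
  refine mem_tailMul.2 ⟨w, hw, ?_⟩
  rw [h1, h2, ← mul_assoc, h3]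
  simp only [mul_assoc]

lemma run_comm (hu : TLFamily β N u) {a J k : ℕ} (h : a + J + 2 ≤ k) (hk : k < N) :
    u k * run u a J = run u a J * u k := by
  induction J with
  | zero => exact (hu.comm a k (by omega) hk).symm
  | succ J ih =>
    rw [run, ← mul_assoc, ih (by omega), mul_assoc, mul_assoc, hu.comm _ k (by omega) hk]

/-- The left ideal of `tail a` generated by `u b, …, u (N - 1)`. -/
def tailIdeal (N : ℕ) (u : ℕ → A) (a b : ℕ) : Submodule ℂ A :=
  Submodule.span ℂ {x | ∃ y ∈ tail N u a, ∃ k, b ≤ k ∧ k < N ∧ x = y * u k}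

/-- The quotient of `tail a` by the left ideal generated by `u (a + J), …, u (N - 1)` is spanned by
a set whose size is an entry of the Catalan triangle. -/
lemma exists_spanning (hu : TLFamily β N u) (m a J : ℕ) (ham : a + m = N) (hJ : J ≤ m + 1) :
    ∃ S : Finset A, (S.card : ℤ) ≤ (m + J + 1).choose J - ((m + J + 1).choose (m + 2) : ℤ) ∧
      (tail N u a).toSubmodule ≤ Submodule.span ℂ (S : Set A) ⊔ tailIdeal N u a (a + J) := by
  classical
  induction m generalizing a J with
  | zero =>
    refine ⟨{1}, ?_, ?_⟩
    -- The algebra consists of scalars, and the bound is 1 for both `J = 0` and `J = 1`.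
    · interval_cases J <;> simp [Nat.choose]
    · rw [tail_eq_bot (by omega)]
      intro x hx
      obtain ⟨r, rfl⟩ := Algebra.mem_bot.1 hx
      rw [Algebra.algebraMap_eq_smul_one]
      exact Submodule.mem_sup_left (Submodule.smul_mem _ _ (Submodule.subset_span (by simp)))
  | succ m ihm =>
    induction J with
    | zero =>
      -- For `J = 0` the ideal contains every generator of `tail a`, so only the class of `1`
      -- survives.
      refine ⟨{1}, by simp, ?_⟩
      intro x hx
      rw [← mul_one x]
      refine tail_mul_mem _ ?_ hx (Submodule.mem_sup_left (Submodule.subset_span (by simp)))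
      intro k hak hk w hw
      obtain ⟨w1, hw1, w2, hw2, rfl⟩ := Submodule.mem_sup.1 hw
      rw [Finset.coe_singleton] at hw1
      obtain ⟨r, rfl⟩ := Submodule.mem_span_singleton.1 hw1
      rw [mul_add]
      refine Submodule.mem_sup_right (Submodule.add_mem _ ?_ ?_)
      · rw [mul_smul_comm, mul_one]
        exact Submodule.smul_mem _ _
          (Submodule.subset_span ⟨1, one_mem _, k, by omega, hk, by simp⟩)
      · suffices tailIdeal N u a (a + 0) ≤
            (tailIdeal N u a (a + 0)).comap (LinearMap.mulLeft ℂ (u k)) from this hw2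
        refine Submodule.span_le.2 ?_
        rintro _ ⟨y, hy, l, hl, hlN, rfl⟩
        exact Submodule.subset_span ⟨u k * y, mul_mem (mem_tail hak hk) hy, l, hl, hlN,
          by rw [LinearMap.mulLeft_apply, mul_assoc]⟩
    | succ J ihJ =>
      obtain ⟨S, hS, hSspan⟩ := ihJ (by omega)
      -- Writing `f m J` for the bound, Pascal's rule in both terms gives `f (m + 1) (J + 1) = f (m
      -- + 1) J + f m (J + 1)`. The first summand is for the quotient that also kills `u (a + J)`,
      -- the second for the left ideal generated by `u (a + J)`.
      have hpascal1 : (m + 1 + (J + 1) + 1).choose (J + 1) =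
          (m + 1 + J + 1).choose J + (m + 1 + J + 1).choose (J + 1) := Nat.choose_succ_succ _ _
      have hpascal2 : (m + 1 + (J + 1) + 1).choose (m + 1 + 2) =
          (m + 1 + J + 1).choose (m + 2) + (m + 1 + J + 1).choose (m + 3) :=
        Nat.choose_succ_succ _ _
      rw [hpascal1, hpascal2]
      have hadd : m + (J + 1) + 1 = m + 1 + J + 1 := by ring
      -- In this case `a + J = N`, so there is no generator `u (a + J)` to restore, and `f m (m + 2)
      -- = 0`.
      by_cases hJm : J = m + 1
      · subst hJm
        refine ⟨S, ?_, hSspan.trans (sup_le_sup le_rfl (Submodule.span_le.2 ?_))⟩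
        · have h2 : (m + 1 + (m + 1) + 1).choose (m + 1 + 1) =
            (m + 1 + (m + 1) + 1).choose (m + 1) := by
            refine Nat.choose_symm_of_eq_add (by ring)
          have h3 : m + 1 + 2 = m + 3 := rfl
          have h4 : m + 1 + 1 = m + 2 := rfl
          rw [h3] at hS
          rw [h4] at h2 ⊢
          push_cast
          linarith
        · rintro _ ⟨y, hy, k, hk, hkN, rfl⟩
          omega
      -- The left ideal of `u (a + J)` lies in `tail (a + 1) * run u a J`. So `T`, which spans `tail
      -- (a + 1)` modulo the generators from `a + J + 2` on, is multiplied on the right by the run.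
      · obtain ⟨T, hT, hTspan⟩ := ihm (a + 1) (J + 1) (by omega) (by omega)
        rw [hadd] at hT
        refine ⟨S ∪ T.image (· * run u a J), ?_, hSspan.trans (sup_le ?_ (Submodule.span_le.2 ?_))⟩
        · have h1 := Finset.card_union_le S (T.image (· * run u a J))
          have h2 : (T.image (· * run u a J)).card ≤ T.card := Finset.card_image_le
          push_cast
          have h3 : m + 1 + 2 = m + 3 := rfl
          rw [h3] at hS
          zify at h1 h2
          linarith
        · exact (Submodule.span_mono (by simp)).trans le_sup_left
        · rintro _ ⟨y, hy, k, hk, hkN, rfl⟩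
          rcases hk.eq_or_lt with rfl | hk
          · obtain ⟨z, hz, hzy⟩ := mem_tailMul.1 (hu.tail_mul_gen_add hkN hy)
            rw [SetLike.mem_coe, ← hzy]
            suffices Submodule.span ℂ (T : Set A) ⊔ tailIdeal N u (a + 1) (a + 1 + (J + 1)) ≤
                (Submodule.span ℂ ((S ∪ T.image (· * run u a J) : Finset A) : Set A) ⊔
                  tailIdeal N u a (a + (J + 1))).comap (LinearMap.mulRight ℂ (run u a J)) from
              this (hTspan hz)
            refine sup_le (Submodule.span_le.2 ?_) (Submodule.span_le.2 ?_)
            · intro t ht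
              refine Submodule.mem_sup_left (Submodule.subset_span ?_)
              rw [Finset.mem_coe, Finset.mem_union]
              exact Or.inr (Finset.mem_image_of_mem _ ht)
            · rintro _ ⟨y, hy, k, hk, hkN', rfl⟩
              -- For `k ≥ a + J + 2`, `u k` commutes with the run, so it moves to the right end and
              -- the product stays in the ideal.
              refine Submodule.mem_sup_right (Submodule.subset_span
                ⟨y * run u a J, mul_mem (tail_anti (Nat.le_succ _) hy) (run_mem hkN), k, by omega,
                  hkN', ?_⟩)
              rw [LinearMap.mulRight_apply, mul_assoc, mul_assoc, hu.run_comm (by omega) hkN']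
          · exact Submodule.mem_sup_right (Submodule.subset_span ⟨y, hy, k, by omega, hkN, rfl⟩)

/-- An algebra generated by a Temperley–Lieb family is spanned by Catalan many elements. -/
lemma exists_spanning_top (hu : TLFamily β N u) (h : tail N u 0 = ⊤) :
    ∃ S : Finset A, S.card ≤ catalan (N + 1) ∧ Submodule.span ℂ (S : Set A) = ⊤ := by
  -- With `J = N + 1` the ideal is zero and the bound is a difference of neighbouring binomials of
  -- `2 * (N + 1)`, which is the Catalan number.
  obtain ⟨S, hS, hspan⟩ := hu.exists_spanning N 0 (N + 1) (by omega) le_rfl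
  refine ⟨S, ?_, ?_⟩
  · have h1 : N + (N + 1) + 1 = 2 * (N + 1) := by ring
    rw [h1] at hS
    have h2 := succ_mul_catalan_eq_centralBinom (N + 1)
    have h3 := Nat.choose_succ_right_eq (2 * (N + 1)) (N + 1)
    rw [Nat.centralBinom] at h2
    have h4 : 2 * (N + 1) - (N + 1) = N + 1 := by omega
    have h6 : N + 1 + 1 = N + 2 := rfl
    rw [h4, h6] at h3
    rw [h6] at h2
    zify at h2 h3 ⊢
    have h5 : ((N : ℤ) + 2) * (((2 * (N + 1)).choose (N + 1) : ℤ) -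
        ((2 * (N + 1)).choose (N + 2) : ℤ)) = ((N : ℤ) + 2) * catalan (N + 1) := by
      linarith
    have h7 := mul_left_cancel₀ (by positivity) h5
    linarith
  · have h0 : tailIdeal N u 0 (0 + (N + 1)) = ⊥ := by
      rw [tailIdeal, Submodule.span_eq_bot]
      rintro _ ⟨y, hy, k, hk, hkN, rfl⟩
      omega
    rw [h0, sup_bot_eq, h, Algebra.top_toSubmodule] at hspan
    exact top_le_iff.1 hspan

end TLFamily

/-! ## The relations between the diagrams of the generators -/

namespace NDiagram

variable {n : ℕ}

/-- The upper of the two points linked by `gen i`. -/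
def fstPt (i : Fin (n - 1)) : Fin n := ⟨i, by omega⟩

/-- The lower of the two points linked by `gen i`. -/
def sndPt (i : Fin (n - 1)) : Fin n := ⟨i + 1, by omega⟩

/-- The colouring `h` with the colours of the points `i` and `i + 1` replaced by `c`. -/
def setPair (i : Fin (n - 1)) (h : Fin n → Bool) (c : Bool) : Fin n → Bool :=
  fun k => if (k : ℕ) = i ∨ (k : ℕ) = i + 1 then c else h k

lemma setPair_fstPt (i : Fin (n - 1)) (h : Fin n → Bool) (c : Bool) :
    setPair i h c (fstPt i) = c := by simp [setPair, fstPt]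

lemma setPair_sndPt (i : Fin (n - 1)) (h : Fin n → Bool) (c : Bool) :
    setPair i h c (sndPt i) = c := by simp [setPair, sndPt]

lemma setPair_of_ne {i : Fin (n - 1)} {k : Fin n} (h : Fin n → Bool) (c : Bool)
    (h1 : (k : ℕ) ≠ i) (h2 : (k : ℕ) ≠ i + 1) : setPair i h c k = h k := by
  simp [setPair, h1, h2]

lemma setPair_injective (i : Fin (n - 1)) (h : Fin n → Bool) :
    Function.Injective (setPair i h) := fun c c' hc => by
  have := congrFun hc (fstPt i)
  rwa [setPair_fstPt, setPair_fstPt] at this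

lemma gen_link_inl (i : Fin (n - 1)) (k : Fin n) : (gen i).link (Sum.inl k) =
    if (k : ℕ) = i then Sum.inl (sndPt i) else if (k : ℕ) = i + 1 then Sum.inl (fstPt i)
      else Sum.inr k := rfl

lemma gen_link_inr (i : Fin (n - 1)) (k : Fin n) : (gen i).link (Sum.inr k) =
    if (k : ℕ) = i then Sum.inr (sndPt i) else if (k : ℕ) = i + 1 then Sum.inr (fstPt i)
      else Sum.inl k := rfl

lemma compat_gen (i : Fin (n - 1)) (g h : Fin n → Bool) :
    (gen i).Compat (Sum.elim g h) ↔ h (fstPt i) = h (sndPt i) ∧ ∃ c, setPair i h c = g := by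
  constructor
  · intro H
    have h1 := H (Sum.inr (fstPt i))
    have h2 := H (Sum.inl (fstPt i))
    simp [gen_link_inr, gen_link_inl, fstPt] at h1 h2
    refine ⟨h1.symm, g (fstPt i), funext fun k => ?_⟩
    simp only [setPair]
    split_ifs with hk
    · rcases hk with hk | hk
      · exact congrArg g (Fin.ext hk.symm)
      · exact h2.symm.trans (congrArg g (Fin.ext hk.symm))
    · push Not at hk
      have := H (Sum.inl k)
      simpa [gen_link_inl, hk.1, hk.2] using this
  · rintro ⟨h1, c, rfl⟩ (k | k)
    · rw [gen_link_inl]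
      split_ifs with hk hk'
      · simp [setPair, hk, sndPt]
      · simp [setPair, hk', fstPt]
      · simp [setPair, hk, hk']
    · rw [gen_link_inr]
      split_ifs with hk hk'
      · exact h1.symm.trans (congrArg h (Fin.ext hk.symm))
      · exact h1.trans (congrArg h (Fin.ext hk'.symm))
      · simp [setPair, hk, hk']

/-- Right multiplication by a generator becomes an explicit operator on colourings. The relations
below are verified with this formula. -/
lemma mul_colourMatrix_gen (M : Matrix (Fin n → Bool) (Fin n → Bool) ℕ) (i : Fin (n - 1))
    (f h : Fin n → Bool) : (M * (gen i).colourMatrix) f h =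
      if h (fstPt i) = h (sndPt i) then ∑ c, M f (setPair i h c) else 0 := by
  classical
  rw [Matrix.mul_apply]
  simp only [colourMatrix, compat_gen]
  split_ifs with hh
  · rw [← Finset.sum_image (s := Finset.univ) (g := setPair i h) (f := fun g => M f g)
      fun c _ c' _ hc => setPair_injective i h hc]
    simp only [mul_ite, mul_one, mul_zero]
    rw [← Finset.sum_filter]
    refine Finset.sum_congr (Finset.ext fun g => ?_) fun _ _ => rfl
    simp only [Finset.mem_filter, Finset.mem_univ, true_and, Finset.mem_image, hh]
  · simp [hh]

/-- The two right points form a link of their own, so their common colour is not constrained by the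
other points. -/
lemma Compat.congr_cup {d : NDiagram n} {i : Fin (n - 1)}
    (hd : d.link (Sum.inr (fstPt i)) = Sum.inr (sndPt i)) {f g h : Fin n → Bool}
    (hg : g (fstPt i) = g (sndPt i)) (hgh : ∀ k : Fin n, (k : ℕ) ≠ i → (k : ℕ) ≠ i + 1 → g k = h k)
    (H : d.Compat (Sum.elim f h)) : d.Compat (Sum.elim f g) := by
  have hd' : d.link (Sum.inr (sndPt i)) = Sum.inr (fstPt i) := by rw [← hd, d.link_link]
  have hv : ∀ p, p ≠ Sum.inr (fstPt i) → p ≠ Sum.inr (sndPt i) →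
      Sum.elim f g p = Sum.elim f h p := by
    rintro (k | k) h1 h2
    · rfl
    · exact hgh k (fun h => h1 (congrArg _ (Fin.ext h))) (fun h => h2 (congrArg _ (Fin.ext h)))
  intro p
  by_cases h1 : p = Sum.inr (fstPt i)
  · rw [h1, hd]; exact hg.symm
  by_cases h2 : p = Sum.inr (sndPt i)
  · rw [h2, hd']; exact hg
  rw [hv p h1 h2, ← H p]
  refine hv _ (fun h => h2 ?_) (fun h => h1 ?_)
  · rw [← hd, ← h, d.link_link]
  · rw [← hd', ← h, d.link_link]

/-- The factor 2 counts the colours of the loop closed by the right link of `d` and the left link of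
`gen i`. -/
lemma colourMatrix_mul_gen_of_cup {d : NDiagram n} {i : Fin (n - 1)}
    (hd : d.link (Sum.inr (fstPt i)) = Sum.inr (sndPt i)) :
    d.colourMatrix * (gen i).colourMatrix = 2 • d.colourMatrix := by
  classical
  ext f h
  rw [mul_colourMatrix_gen, Matrix.smul_apply]
  by_cases hh : h (fstPt i) = h (sndPt i)
  · rw [if_pos hh]
    have : ∀ c, d.colourMatrix f (setPair i h c) = d.colourMatrix f h := by
      intro c
      refine if_congr ⟨fun H => H.congr_cup hd hh fun k h1 h2 => ?_, fun H =>
        H.congr_cup hd ?_ fun k h1 h2 => ?_⟩ rfl rfl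
      · exact (setPair_of_ne h c h1 h2).symm
      · rw [setPair_fstPt, setPair_sndPt]
      · exact setPair_of_ne h c h1 h2
    simp [this, two_mul]
  · rw [if_neg hh]
    have : ¬ d.Compat (Sum.elim f h) := fun H => hh (by simpa [hd] using (H (Sum.inr (fstPt i))).symm)
    simp [colourMatrix, this]

lemma comp_gen_of_cup {d : NDiagram n} {i : Fin (n - 1)}
    (hd : d.link (Sum.inr (fstPt i)) = Sum.inr (sndPt i)) :
    d.comp (gen i) = d ∧ loops d (gen i) = 1 := by
  refine eq_of_colourMatrix _ _ _ _ ?_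
  rw [← colourMatrix_mul, colourMatrix_mul_gen_of_cup hd, pow_one]

lemma gen_link_fstPt (i : Fin (n - 1)) :
    (gen i).link (Sum.inr (fstPt i)) = Sum.inr (sndPt i) := by simp [gen_link_inr, fstPt]

lemma colourMatrix_gen_comm (i j : Fin (n - 1)) (hij : (i : ℕ) + 2 ≤ j) :
    (gen i).colourMatrix * (gen j).colourMatrix = (gen j).colourMatrix * (gen i).colourMatrix := by
  -- With an arbitrary matrix on the left, every generator acts through `mul_colourMatrix_gen` and
  -- no entry of a generator has to be evaluated.
  suffices ∀ M : Matrix (Fin n → Bool) (Fin n → Bool) ℕ,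
      M * (gen i).colourMatrix * (gen j).colourMatrix =
        M * (gen j).colourMatrix * (gen i).colourMatrix by
    simpa only [Matrix.one_mul] using this 1
  intro M
  ext f h
  simp only [mul_colourMatrix_gen]
  have e1 : ∀ c, setPair j h c (fstPt i) = h (fstPt i) := fun c =>
    setPair_of_ne h c (by simp [fstPt]; omega) (by simp [fstPt]; omega)
  have e2 : ∀ c, setPair j h c (sndPt i) = h (sndPt i) := fun c =>
    setPair_of_ne h c (by simp [sndPt]; omega) (by simp [sndPt]; omega)
  have e3 : ∀ c, setPair i h c (fstPt j) = h (fstPt j) := fun c =>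
    setPair_of_ne h c (by simp [fstPt]; omega) (by simp [fstPt]; omega)
  have e4 : ∀ c, setPair i h c (sndPt j) = h (sndPt j) := fun c =>
    setPair_of_ne h c (by simp [sndPt]; omega) (by simp [sndPt]; omega)
  have e5 : ∀ b c, setPair i (setPair j h c) b = setPair j (setPair i h b) c := by
    intro b c
    funext k
    simp only [setPair]
    split_ifs <;> first | rfl | omega
  simp only [e1, e2, e3, e4, e5]
  split_ifs
  · exact Finset.sum_comm
  all_goals simp

/-- The pairs of `i` and `j` share one point. The two inner equality conditions fix two of the three
summed colours to that of the unshared point of `j`, and only the sum of a single `gen i` remains.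
-/
lemma colourMatrix_gen_neighbour (i j : Fin (n - 1)) (hij : (i : ℕ) + 1 = j ∨ (j : ℕ) + 1 = i) :
    (gen i).colourMatrix * (gen j).colourMatrix * (gen i).colourMatrix = (gen i).colourMatrix := by
  suffices ∀ M : Matrix (Fin n → Bool) (Fin n → Bool) ℕ,
      M * (gen i).colourMatrix * (gen j).colourMatrix * (gen i).colourMatrix =
        M * (gen i).colourMatrix by
    simpa only [Matrix.one_mul] using this 1
  intro M
  ext f h
  simp only [mul_colourMatrix_gen]
  split_ifs with hh
  -- The point `k` is the member of the pair of `j` outside the pair of `i`.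
  · obtain ⟨k, hki, hki', hk⟩ : ∃ k : Fin n, (k : ℕ) ≠ i ∧ (k : ℕ) ≠ i + 1 ∧
        ∀ l : Fin n, ((l : ℕ) = j ∨ (l : ℕ) = j + 1) → l = k ∨ (l : ℕ) = i ∨ (l : ℕ) = i + 1 := by
      rcases hij with hij | hij
      · exact ⟨sndPt j, by simp [sndPt]; omega, by simp [sndPt]; omega, fun l hl => by
          rw [Fin.ext_iff]; simp only [sndPt]; omega⟩
      · exact ⟨fstPt j, by simp [fstPt]; omega, by simp [fstPt]; omega, fun l hl => by
          rw [Fin.ext_iff]; simp only [fstPt]; omega⟩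
    have e1 : ∀ b, (setPair i h b (fstPt j) = setPair i h b (sndPt j)) ↔ h k = b := by
      intro b
      rcases hij with hij | hij
      · have : k = sndPt j := by
          have := hk (sndPt j) (Or.inr rfl)
          simp [sndPt, Fin.ext_iff] at this ⊢
          omega
        subst this
        rw [setPair_of_ne h b hki hki']
        simp [setPair, fstPt, hij, eq_comm]
      · have : k = fstPt j := by
          have := hk (fstPt j) (Or.inl rfl)
          simp [fstPt, Fin.ext_iff] at this ⊢
          omega
        subst this
        rw [setPair_of_ne h b hki hki']
        simp [setPair, sndPt, hij]
    have e2 : ∀ b c, (setPair j (setPair i h b) c (fstPt i) =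
        setPair j (setPair i h b) c (sndPt i)) ↔ b = c := by
      intro b c
      rcases hij with hij | hij
      · have h1 : (i : ℕ) ≠ j := by omega
        have h2 : (i : ℕ) ≠ j + 1 := by omega
        simp [setPair, fstPt, sndPt, h1, h2, hij]
      · have h1 : ¬ ((i : ℕ) + 1 = j ∨ (i : ℕ) + 1 = j + 1) := by omega
        have h2 : (i : ℕ) = j ∨ (i : ℕ) = j + 1 := by omega
        simp only [setPair, fstPt, sndPt, if_pos h2, if_neg h1, or_true, if_true]
        exact eq_comm
    -- The inner replacements rewrite `k` with its own colour and otherwise touch only the pair of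
    -- `i`, which the outer one overwrites.
    have e3 : ∀ e, setPair i (setPair j (setPair i h (h k)) (h k)) e = setPair i h e := by
      intro e
      funext l
      have := hk l
      simp only [setPair]
      split_ifs with h1 h2
      · rfl
      · rcases this h2 with rfl | h4
        · rfl
        · exact absurd h4 h1
      · rfl
    simp only [e1, e2]
    rw [Finset.sum_ite_eq, if_pos (Finset.mem_univ _), Finset.sum_ite_eq,
      if_pos (Finset.mem_univ _)]
    simp only [e3]
  · rfl

lemma comp_gen_comm (i j : Fin (n - 1)) (hij : (i : ℕ) + 2 ≤ j) :
    (gen i).comp (gen j) = (gen j).comp (gen i) ∧ loops (gen i) (gen j) = loops (gen j) (gen i) := by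
  refine eq_of_colourMatrix _ _ _ _ ?_
  rw [← colourMatrix_mul, ← colourMatrix_mul, colourMatrix_gen_comm i j hij]

/-- A link between the right points `i` and `i + 1` is moved by one step by a neighbouring
generator, and moved back by the generator `gen i`. -/
lemma comp_gen_comp_gen {d : NDiagram n} {i j : Fin (n - 1)}
    (hij : (i : ℕ) + 1 = j ∨ (j : ℕ) + 1 = i)
    (hd : d.link (Sum.inr (fstPt i)) = Sum.inr (sndPt i)) :
    (d.comp (gen j)).comp (gen i) = d ∧ loops d (gen j) + loops (d.comp (gen j)) (gen i) = 0 := by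
  refine eq_of_colourMatrix _ _ _ _ ?_
  rw [pow_add, mul_smul, ← colourMatrix_mul, ← Matrix.smul_mul, ← colourMatrix_mul, pow_zero,
    one_smul]
  -- Replacing `2 • d` by `d * gen i` creates the pattern `gen i * gen j * gen i`. The factor 2 is
  -- cancelled entrywise in `ℕ`.
  have h : 2 • (d.colourMatrix * (gen j).colourMatrix * (gen i).colourMatrix) =
      2 • d.colourMatrix := by
    rw [← Matrix.smul_mul, ← Matrix.smul_mul, ← colourMatrix_mul_gen_of_cup hd, Matrix.mul_assoc,
      Matrix.mul_assoc, ← Matrix.mul_assoc (gen i).colourMatrix,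
      colourMatrix_gen_neighbour i j hij]
  ext f g
  have := congrFun (congrFun h f) g
  simpa using this

end NDiagram

namespace NDiagramAlgebra

open NDiagram

lemma ofDiagram_mul {n : ℕ} {β : ℂ} (d e : NDiagram n) :
    (ofDiagram β d * ofDiagram β e) = β ^ loops d e • ofDiagram β (d.comp e) := by
  simp only [ofDiagram, single_mul_single, smul_single, mul_one, one_mul]

/-- This moves a right link to a neighbouring position: `d.comp (gen j)` has it at `j`, and `d` is
recovered without loops. -/
lemma ofDiagram_mul_gen_mul_gen {n : ℕ} {β : ℂ} {d : NDiagram n} {i j : Fin (n - 1)}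
    (hij : (i : ℕ) + 1 = j ∨ (j : ℕ) + 1 = i)
    (hd : d.link (Sum.inr (fstPt i)) = Sum.inr (sndPt i)) :
    ofDiagram β d = ofDiagram β (d.comp (gen j)) * ofDiagram β (gen i) := by
  obtain ⟨h1, h2⟩ := comp_gen_comp_gen hij hd
  have h3 : loops (d.comp (gen j)) (gen i) = 0 := by omega
  rw [ofDiagram_mul, h1, h3, pow_zero, one_smul]

lemma gen_mul_gen {n : ℕ} {β : ℂ} (i : Fin (n - 1)) :
    ofDiagram β (gen i) * ofDiagram β (gen i) = β • ofDiagram β (gen i) := by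
  obtain ⟨h1, h2⟩ := comp_gen_of_cup (gen_link_fstPt i)
  rw [ofDiagram_mul, h1, h2, pow_one]

lemma gen_mul_gen_mul_gen {n : ℕ} {β : ℂ} (i j : Fin (n - 1))
    (hij : (i : ℕ) + 1 = j ∨ (j : ℕ) + 1 = i) :
    ofDiagram β (gen i) * ofDiagram β (gen j) * ofDiagram β (gen i) = ofDiagram β (gen i) := by
  obtain ⟨h1, h2⟩ := comp_gen_comp_gen hij (gen_link_fstPt i)
  rw [ofDiagram_mul, smul_mul_assoc, ofDiagram_mul, h1, smul_smul, ← pow_add, h2, pow_zero,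
    one_smul]

lemma gen_comm {n : ℕ} {β : ℂ} (i j : Fin (n - 1)) (hij : (i : ℕ) + 2 ≤ j) :
    ofDiagram β (gen i) * ofDiagram β (gen j) = ofDiagram β (gen j) * ofDiagram β (gen i) := by
  obtain ⟨h1, h2⟩ := comp_gen_comm i j hij
  rw [ofDiagram_mul, ofDiagram_mul, h1, h2]

end NDiagramAlgebra

/-! ## The diagrams of the generators generate the diagram algebra -/

namespace NDiagram

variable {n : ℕ}

/-- All points from `m` on are linked to the opposite points. -/
def TrivialFrom (m : ℕ) (d : NDiagram n) : Prop :=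
  ∀ k : Fin n, m ≤ k → d.link (Sum.inl k) = Sum.inr k

lemma comp_link_of_reachable {d e : NDiagram n} {p q : Fin n ⊕ Fin n} (hne : q ≠ p)
    (h : (d.concat e).Reachable (outer p) (outer q)) : (d.comp e).link p = q :=
  (comp_link_eq_iff d e p q).2 ⟨hne, h⟩

lemma comp_eq_of_reachable {c d e : NDiagram n}
    (h : ∀ p, (d.concat e).Reachable (outer p) (outer (c.link p))) : d.comp e = c :=
  NDiagram.ext (funext fun p => comp_link_of_reachable (c.link_ne p) (h p))

lemma loops_eq_zero {d e : NDiagram n}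
    (h : ∀ j, ∃ p, (d.concat e).Reachable (outer p) (Sum.inr (Sum.inl j))) : loops d e = 0 := by
  rw [loops, Nat.card_eq_zero]
  refine Or.inl ⟨?_⟩
  rintro ⟨c, hc⟩
  induction c using SimpleGraph.ConnectedComponent.ind with | _ v => ?_
  rcases v with i | j | k
  · exact hc (Sum.inl i) rfl
  · obtain ⟨p, hp⟩ := h j
    exact hc p (SimpleGraph.ConnectedComponent.sound hp)
  · exact hc (Sum.inr k) rfl

lemma TrivialFrom.comp {m : ℕ} {d e : NDiagram n} (hd : d.TrivialFrom m) (he : e.TrivialFrom m) :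
    (d.comp e).TrivialFrom m := by
  intro k hk
  refine comp_link_of_reachable (by simp) ?_
  have h1 := adj_inFst d e (Sum.inl k)
  have h2 := adj_inSnd d e (Sum.inl k)
  rw [hd k hk] at h1
  rw [he k hk] at h2
  exact h1.reachable.trans h2.reachable

lemma trivialFrom_gen {m : ℕ} (i : Fin (n - 1)) (h : (i : ℕ) + 2 ≤ m) :
    (gen i).TrivialFrom m := by
  intro k hk
  rw [gen_link_inl, if_neg (by omega), if_neg (by omega)]

lemma comp_gen_link (d : NDiagram n) (i : Fin (n - 1)) :
    (d.comp (gen i)).link (Sum.inr (fstPt i)) = Sum.inr (sndPt i) := by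
  refine comp_link_of_reachable (by simp [fstPt, sndPt]) ?_
  have h := adj_inSnd d (gen i) (Sum.inr (fstPt i))
  rw [gen_link_fstPt] at h
  exact h.reachable

/-- An innermost link joins neighbours: if `b` is not `a + 1`, then planarity forces the partner of
`a + 1` to lie between `a` and `b`, and the gap shrinks. -/
lemma exists_cup_of_link {d : NDiagram n} (a b : Fin n) (hab : a < b)
    (h : d.link (Sum.inr a) = Sum.inr b) :
    ∃ i : Fin (n - 1), d.link (Sum.inr (fstPt i)) = Sum.inr (sndPt i) := by
  obtain ⟨g, hg⟩ : ∃ g, (b : ℕ) - a ≤ g := ⟨_, le_rfl⟩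
  induction g generalizing a b with
  | zero => omega
  | succ g ih =>
    have hb := b.2
    by_cases hb1 : (b : ℕ) = a + 1
    · refine ⟨⟨a, by omega⟩, ?_⟩
      have e1 : fstPt (⟨a, by omega⟩ : Fin (n - 1)) = a := rfl
      have e2 : sndPt (⟨a, by omega⟩ : Fin (n - 1)) = b := Fin.ext hb1.symm
      rw [e1, e2, h]
    · have hlt : (a : ℕ) < b := hab
      let c : Fin n := ⟨a + 1, by omega⟩
      have hc : (c : ℕ) = a + 1 := rfl
      have h' : d.link (Sum.inr b) = Sum.inr a := by rw [← h, d.link_link]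
      have p1 := d.planar (Sum.inr b) (Sum.inr c)
      have p2 := d.planar (d.link (Sum.inr c)) (Sum.inr b)
      have n1 : d.link (Sum.inr c) ≠ Sum.inr a := fun hh => by
        have := congrArg d.link hh
        rw [d.link_link, h] at this
        have := Fin.ext_iff.1 (Sum.inr_injective this)
        omega
      have n2 : d.link (Sum.inr c) ≠ Sum.inr b := fun hh => by
        have := congrArg d.link hh
        rw [d.link_link, h'] at this
        have := Fin.ext_iff.1 (Sum.inr_injective this)
        omega
      have n3 := d.link_ne (Sum.inr c)
      rw [d.link_link] at p2
      rw [h'] at p1 p2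
      rcases hx : d.link (Sum.inr c) with x | x
      · rw [hx] at p1 p2
        have := x.2
        simp only [boundaryPos] at p1 p2
        omega
      · rw [hx] at p1 p2 n1 n2 n3
        have := x.2
        have n1' : (x : ℕ) ≠ a := fun h => n1 (congrArg _ (Fin.ext h))
        have n2' : (x : ℕ) ≠ b := fun h => n2 (congrArg _ (Fin.ext h))
        have n3' : (x : ℕ) ≠ c := fun h => n3 (congrArg _ (Fin.ext h))
        simp only [boundaryPos] at p1 p2
        exact ih c x (Fin.lt_def.2 (by omega)) hx (by omega)

/-- Without right-to-right links every right point is linked to a left one. Planarity makes this map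
`Fin n → Fin n` strictly increasing, hence the identity. -/
lemma eq_one_of_no_cup {d : NDiagram n}
    (h : ∀ i : Fin (n - 1), d.link (Sum.inr (fstPt i)) ≠ Sum.inr (sndPt i)) :
    d = NDiagram.one n := by
  have h1 : ∀ k, ∃ l, d.link (Sum.inr k) = Sum.inl l := by
    intro k
    rcases hl : d.link (Sum.inr k) with l | l
    · exact ⟨l, rfl⟩
    · exfalso
      rcases lt_trichotomy k l with hkl | rfl | hkl
      · obtain ⟨i, hi⟩ := exists_cup_of_link k l hkl hl
        exact h i hi
      · exact d.link_ne _ hl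
      · obtain ⟨i, hi⟩ := exists_cup_of_link l k hkl (by rw [← hl, d.link_link])
        exact h i hi
  choose σ hσ using h1
  have hσ' : ∀ k, d.link (Sum.inl (σ k)) = Sum.inr k := fun k => by rw [← hσ, d.link_link]
  have hmono : StrictMono σ := by
    intro a b hab
    by_contra hle
    rcases (not_lt.1 hle).eq_or_lt with heq | hlt
    · have h2 := hσ' a
      rw [← heq, hσ' b] at h2
      exact hab.ne (Sum.inr_injective h2).symm
    · have := d.planar (Sum.inl (σ b)) (Sum.inl (σ a))
      rw [hσ', hσ'] at this
      simp only [boundaryPos] at this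
      have h3 : (a : ℕ) < b := hab
      have h4 : (σ b : ℕ) < σ a := hlt
      have := a.2
      have := b.2
      have := (σ a).2
      omega
  have hid : ∀ k, σ k = k := fun k => le_antisymm hmono.apply_le hmono.le_apply
  refine NDiagram.ext (funext fun p => ?_)
  rcases p with k | k
  · have := hσ' k
    rw [hid] at this
    exact this
  · have := hσ k
    rw [hid] at this
    exact this

/-! ### Splitting off a generator at the end of the nontrivial part -/

section Bend

/-- The links of a diagram, after a link between the last two right points `i` and `i + 1` is
replaced by a link between the left and the right point `i + 1`, and the former partner of the left
point `i + 1` is linked to the right point `i`. -/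
def bendLink (d : NDiagram n) (i : Fin (n - 1)) (q : Fin n ⊕ Fin n) : Fin n ⊕ Fin n :=
  if q = Sum.inl (sndPt i) then Sum.inr (sndPt i)
  else if q = Sum.inr (sndPt i) then Sum.inl (sndPt i)
  else if q = d.link (Sum.inl (sndPt i)) then Sum.inr (fstPt i)
  else if q = Sum.inr (fstPt i) then d.link (Sum.inl (sndPt i))
  else d.link q

variable {d : NDiagram n} {i : Fin (n - 1)}

lemma bend_aux (hd : d.link (Sum.inr (fstPt i)) = Sum.inr (sndPt i)) :
    d.link (Sum.inr (sndPt i)) = Sum.inr (fstPt i) ∧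
    d.link (Sum.inl (sndPt i)) ≠ Sum.inl (sndPt i) ∧
    d.link (Sum.inl (sndPt i)) ≠ Sum.inr (sndPt i) ∧
    d.link (Sum.inl (sndPt i)) ≠ Sum.inr (fstPt i) ∧
    (Sum.inr (sndPt i) : Fin n ⊕ Fin n) ≠ Sum.inr (fstPt i) := by
  have h1 : d.link (Sum.inr (sndPt i)) = Sum.inr (fstPt i) := by rw [← hd, d.link_link]
  refine ⟨h1, d.link_ne _, fun h => ?_, fun h => ?_, by simp [fstPt, sndPt]⟩
  · have := congrArg d.link h
    rw [d.link_link, h1] at this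
    simp at this
  · have := congrArg d.link h
    rw [d.link_link, hd] at this
    simp at this

lemma bendLink_left : bendLink d i (Sum.inl (sndPt i)) = Sum.inr (sndPt i) := if_pos rfl

lemma bendLink_right : bendLink d i (Sum.inr (sndPt i)) = Sum.inl (sndPt i) := by
  simp [bendLink]

lemma bendLink_partner (hd : d.link (Sum.inr (fstPt i)) = Sum.inr (sndPt i)) :
    bendLink d i (d.link (Sum.inl (sndPt i))) = Sum.inr (fstPt i) := by
  obtain ⟨h1, h2, h3, h4, h5⟩ := bend_aux hd
  rw [bendLink, if_neg h2, if_neg h3, if_pos rfl]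

lemma bendLink_fst (hd : d.link (Sum.inr (fstPt i)) = Sum.inr (sndPt i)) :
    bendLink d i (Sum.inr (fstPt i)) = d.link (Sum.inl (sndPt i)) := by
  obtain ⟨h1, h2, h3, h4, h5⟩ := bend_aux hd
  rw [bendLink, if_neg (by simp), if_neg h5.symm, if_neg h4.symm, if_pos rfl]

lemma bendLink_other {q : Fin n ⊕ Fin n} (h1 : q ≠ Sum.inl (sndPt i)) (h2 : q ≠ Sum.inr (sndPt i))
    (h3 : q ≠ d.link (Sum.inl (sndPt i))) (h4 : q ≠ Sum.inr (fstPt i)) :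
    bendLink d i q = d.link q := by
  rw [bendLink, if_neg h1, if_neg h2, if_neg h3, if_neg h4]

lemma link_other (hd : d.link (Sum.inr (fstPt i)) = Sum.inr (sndPt i)) {q : Fin n ⊕ Fin n}
    (h1 : q ≠ Sum.inl (sndPt i)) (h2 : q ≠ Sum.inr (sndPt i))
    (h3 : q ≠ d.link (Sum.inl (sndPt i))) (h4 : q ≠ Sum.inr (fstPt i)) :
    d.link q ≠ Sum.inl (sndPt i) ∧ d.link q ≠ Sum.inr (sndPt i) ∧
      d.link q ≠ d.link (Sum.inl (sndPt i)) ∧ d.link q ≠ Sum.inr (fstPt i) := by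
  refine ⟨fun h => h3 ?_, fun h => h4 ?_, fun h => h1 ?_, fun h => h2 ?_⟩
  · rw [← h, d.link_link]
  · rw [← d.link_link q, h, (bend_aux hd).1]
  · rw [← d.link_link q, h, d.link_link]
  · rw [← d.link_link q, h, hd]

lemma bendLink_cases (d : NDiagram n) (i : Fin (n - 1)) (q : Fin n ⊕ Fin n) :
    q = Sum.inl (sndPt i) ∨ q = Sum.inr (sndPt i) ∨ q = d.link (Sum.inl (sndPt i)) ∨
      q = Sum.inr (fstPt i) ∨ (q ≠ Sum.inl (sndPt i) ∧ q ≠ Sum.inr (sndPt i) ∧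
        q ≠ d.link (Sum.inl (sndPt i)) ∧ q ≠ Sum.inr (fstPt i)) := by tauto

/-- The field `planar` excludes one order of interlacing, so it is used for `t, s` and for `d.link
s, t`. -/
lemma link_between (d : NDiagram n) (s t : Fin n ⊕ Fin n) (hs : s ≠ t) (hs' : s ≠ d.link t)
    (h : boundaryPos t < boundaryPos s ∧ boundaryPos s < boundaryPos (d.link t)) :
    boundaryPos t < boundaryPos (d.link s) ∧ boundaryPos (d.link s) < boundaryPos (d.link t) := by
  have h1 : boundaryPos (d.link s) ≠ boundaryPos t := fun h => hs' (by
    rw [← boundaryPos_injective h, d.link_link])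
  have h2 : boundaryPos (d.link s) ≠ boundaryPos (d.link t) := fun h => hs (by
    rw [← d.link_link s, boundaryPos_injective h, d.link_link])
  have h3 := d.planar t s
  have h4 := d.planar (d.link s) t
  rw [d.link_link] at h4
  omega

/-- Straight links reflect the boundary positions by `x ↦ 2 * n - 1 - x`, and the positions of the
straight part form a window symmetric under this. -/
lemma boundaryPos_link_of_trivialFrom {m : ℕ} (ht : d.TrivialFrom m) (s : Fin n ⊕ Fin n)
    (h1 : m ≤ boundaryPos s) (h2 : boundaryPos s < 2 * n - m) :
    boundaryPos (d.link s) = 2 * n - 1 - boundaryPos s := by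
  rcases s with k | k
  · rw [ht k h1]
    rfl
  · simp only [boundaryPos] at h1 h2
    rw [← ht k (by omega), d.link_link, ht k (by omega)]
    simp only [boundaryPos]
    omega

/-- No point other than the ends of the new links is separated from its partner by a new link. -/
lemma bend_between (hd : d.link (Sum.inr (fstPt i)) = Sum.inr (sndPt i))
    (ht : d.TrivialFrom (i + 2)) {s : Fin n ⊕ Fin n} (s1 : s ≠ Sum.inl (sndPt i))
    (s2 : s ≠ Sum.inr (sndPt i)) (s3 : s ≠ d.link (Sum.inl (sndPt i)))
    (s4 : s ≠ Sum.inr (fstPt i)) :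
    ((i : ℕ) + 1 < boundaryPos s ∧ boundaryPos s < 2 * n - 2 - i →
      (i : ℕ) + 1 < boundaryPos (d.link s) ∧ boundaryPos (d.link s) < 2 * n - 2 - i) ∧
    (boundaryPos (d.link (Sum.inl (sndPt i))) < boundaryPos s ∧ boundaryPos s < 2 * n - 1 - i →
      boundaryPos (d.link (Sum.inl (sndPt i))) < boundaryPos (d.link s) ∧
        boundaryPos (d.link s) < 2 * n - 1 - i) ∧
    (2 * n - 1 - i < boundaryPos s ∧ boundaryPos s < boundaryPos (d.link (Sum.inl (sndPt i))) →
      2 * n - 1 - i < boundaryPos (d.link s) ∧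
        boundaryPos (d.link s) < boundaryPos (d.link (Sum.inl (sndPt i)))) := by
  have hne : ∀ s t : Fin n ⊕ Fin n, s ≠ t → boundaryPos s ≠ boundaryPos t :=
    fun s t h h' => h (boundaryPos_injective h')
  have fL : boundaryPos (Sum.inl (sndPt i) : Fin n ⊕ Fin n) = i + 1 := rfl
  have fR : boundaryPos (Sum.inr (sndPt i) : Fin n ⊕ Fin n) = 2 * n - 1 - (i + 1) := rfl
  have fR' : boundaryPos (Sum.inr (fstPt i) : Fin n ⊕ Fin n) = 2 * n - 1 - i := rfl
  have hi := i.2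
  obtain ⟨-, p1, p2, p3, -⟩ := bend_aux hd
  obtain ⟨t1, t2, t3, t4⟩ := link_other hd s1 s2 s3 s4
  have k1 := d.link_between s _ s1 s3
  have k2 := d.link_between s (d.link (Sum.inl (sndPt i))) s3 (by rwa [d.link_link])
  rw [d.link_link] at k2
  have through : ∀ s, (i : ℕ) + 1 < boundaryPos s ∧ boundaryPos s < 2 * n - 2 - i →
      (i : ℕ) + 1 < boundaryPos (d.link s) ∧ boundaryPos (d.link s) < 2 * n - 2 - i := by
    intro s hs
    have := boundaryPos_link_of_trivialFrom ht s (by omega) (by omega)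
    omega
  have T1 := through s
  have T2 := through (d.link s)
  have TP := through (d.link (Sum.inl (sndPt i)))
  rw [d.link_link] at T2 TP
  rw [fL] at k1 k2 TP
  replace p1 := hne _ _ p1
  replace p2 := hne _ _ p2
  replace p3 := hne _ _ p3
  replace s1 := hne _ _ s1
  replace s2 := hne _ _ s2
  replace s4 := hne _ _ s4
  replace t1 := hne _ _ t1
  replace t2 := hne _ _ t2
  replace t4 := hne _ _ t4
  rw [fL] at p1 s1 t1
  rw [fR] at p2 s2 t2
  rw [fR'] at p3 s4 t4
  generalize boundaryPos (d.link (Sum.inl (sndPt i))) = P at *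
  generalize boundaryPos (d.link s) = S' at *
  generalize boundaryPos s = S at *
  clear through hne fL fR fR' s3 t3
  -- Here `c` is the position of the right point `i + 1`, and `c + 1` that of the right point `i`.
  -- Naming it removes the truncated subtractions.
  obtain ⟨c, hc⟩ : ∃ c, c = 2 * n - 2 - (i : ℕ) := ⟨_, rfl⟩
  have hc' : 2 * n - 1 - (i : ℕ) = c + 1 := by omega
  have hc2 : 2 * n - 1 - ((i : ℕ) + 1) = c := by omega
  have hbc : (i : ℕ) + 1 < c := by omega
  rw [hc2] at p2 s2 t2
  rw [hc'] at p3 s4 t4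
  rw [← hc] at T1 T2 TP
  rw [hc', ← hc]
  clear hc hc' hc2 hi
  -- The window between the two points `i + 1` is closed under links, so the partner of the left
  -- point `i + 1` lies outside it.
  have hP : P < i + 1 ∨ c + 1 < P := by omega
  clear TP p1 p2 p3
  refine ⟨T1, ?_, ?_⟩
  · rcases hP with hP | hP <;> omega
  · rcases hP with hP | hP <;> omega

lemma bendLink_planar (hd : d.link (Sum.inr (fstPt i)) = Sum.inr (sndPt i))
    (ht : d.TrivialFrom (i + 2)) (p q : Fin n ⊕ Fin n) :
    ¬ (boundaryPos p < boundaryPos q ∧ boundaryPos q < boundaryPos (bendLink d i p) ∧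
      boundaryPos (bendLink d i p) < boundaryPos (bendLink d i q)) := by
  have fL : boundaryPos (Sum.inl (sndPt i) : Fin n ⊕ Fin n) = i + 1 := rfl
  have fR : boundaryPos (Sum.inr (sndPt i) : Fin n ⊕ Fin n) = 2 * n - 1 - (i + 1) := rfl
  have fR' : boundaryPos (Sum.inr (fstPt i) : Fin n ⊕ Fin n) = 2 * n - 1 - i := rfl
  have hi := i.2
  have hne : ∀ s t : Fin n ⊕ Fin n, s ≠ t → boundaryPos s ≠ boundaryPos t :=
    fun s t h h' => h (boundaryPos_injective h')
  obtain ⟨-, p1, p2, p3, -⟩ := bend_aux hd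
  have throughP := boundaryPos_link_of_trivialFrom ht (d.link (Sum.inl (sndPt i)))
  rw [d.link_link] at throughP
  replace p1 := hne _ _ p1
  replace p2 := hne _ _ p2
  replace p3 := hne _ _ p3
  -- Two unchanged links do not cross by planarity of `d`, and an unchanged link does not cross a
  -- new one by `bend_between`. Two new links are compared by their positions.
  rcases bendLink_cases d i p with rfl | rfl | rfl | rfl | ⟨hp1, hp2, hp3, hp4⟩
  case' inr.inr.inr.inr =>
    have bp := bend_between hd ht hp1 hp2 hp3 hp4
    obtain ⟨lp1, lp2, lp3, lp4⟩ := link_other hd hp1 hp2 hp3 hp4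
    have bp' := bend_between hd ht lp1 lp2 lp3 lp4
    rw [bendLink_other hp1 hp2 hp3 hp4]
    rw [d.link_link] at bp'
  all_goals
    rcases bendLink_cases d i q with rfl | rfl | rfl | rfl | ⟨hq1, hq2, hq3, hq4⟩
    case' inr.inr.inr.inr =>
      have bq := bend_between hd ht hq1 hq2 hq3 hq4
      obtain ⟨lq1, lq2, lq3, lq4⟩ := link_other hd hq1 hq2 hq3 hq4
      have bq' := bend_between hd ht lq1 lq2 lq3 lq4
      rw [bendLink_other hq1 hq2 hq3 hq4]
      rw [d.link_link] at bq'
  case inr.inr.inr.inr.inr.inr.inr.inr => exact d.planar p q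
  all_goals
    try simp only [bendLink_left, bendLink_right, bendLink_partner hd, bendLink_fst hd]
    simp only [fL, fR, fR'] at *
    omega

end Bend

end NDiagram

namespace NDiagram

variable {n : ℕ} {d : NDiagram n} {i : Fin (n - 1)}

/-- The diagram with the links `bendLink`. -/
def bend (hd : d.link (Sum.inr (fstPt i)) = Sum.inr (sndPt i)) (ht : d.TrivialFrom (i + 2)) :
    NDiagram n where
  link := bendLink d i
  link_link q := by
    rcases bendLink_cases d i q with rfl | rfl | rfl | rfl | ⟨h1, h2, h3, h4⟩
    · rw [bendLink_left, bendLink_right]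
    · rw [bendLink_right, bendLink_left]
    · rw [bendLink_partner hd, bendLink_fst hd]
    · rw [bendLink_fst hd, bendLink_partner hd]
    · obtain ⟨l1, l2, l3, l4⟩ := link_other hd h1 h2 h3 h4
      rw [bendLink_other h1 h2 h3 h4, bendLink_other l1 l2 l3 l4, d.link_link]
  link_ne q := by
    rcases bendLink_cases d i q with rfl | rfl | rfl | rfl | ⟨h1, h2, h3, h4⟩
    · rw [bendLink_left]; simp
    · rw [bendLink_right]; simp
    · rw [bendLink_partner hd]; exact (bend_aux hd).2.2.2.1.symm
    · rw [bendLink_fst hd]; exact (bend_aux hd).2.2.2.1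
    · rw [bendLink_other h1 h2 h3 h4]; exact d.link_ne q
  planar := bendLink_planar hd ht

variable (hd : d.link (Sum.inr (fstPt i)) = Sum.inr (sndPt i)) (ht : d.TrivialFrom (i + 2))

lemma trivialFrom_bend : (bend hd ht).TrivialFrom (i + 1) := by
  intro k hk
  change bendLink d i (Sum.inl k) = Sum.inr k
  by_cases hk' : (k : ℕ) = i + 1
  · have : k = sndPt i := Fin.ext hk'
    rw [this, bendLink_left]
  · have hk2 : d.link (Sum.inl k) = Sum.inr k := ht k (by omega)
    have hks : k ≠ sndPt i := fun h => hk' (congrArg Fin.val h)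
    rw [bendLink_other (by simpa using hks) (by simp) ?_ (by simp), hk2]
    intro h
    have := congrArg d.link h
    rw [hk2, d.link_link] at this
    simp at this

lemma reachable_bend_mid (hd : d.link (Sum.inr (fstPt i)) = Sum.inr (sndPt i))
    (ht : d.TrivialFrom (i + 2)) {q : Fin n ⊕ Fin n} (h2 : q ≠ Sum.inr (sndPt i))
    (h4 : q ≠ Sum.inr (fstPt i)) :
    ((bend hd ht).concat (gen i)).Reachable (outer q) (inFst q) := by
  rcases q with k | k
  · exact SimpleGraph.Reachable.refl _
  · have h := adj_inSnd (bend hd ht) (gen i) (Sum.inl k)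
    have hk1 : (k : ℕ) ≠ i := fun h => h4 (congrArg _ (Fin.ext h))
    have hk2 : (k : ℕ) ≠ i + 1 := fun h => h2 (congrArg _ (Fin.ext h))
    rw [gen_link_inl, if_neg hk1, if_neg hk2] at h
    exact h.reachable.symm

lemma reachable_bend_link (q : Fin n ⊕ Fin n) :
    ((bend hd ht).concat (gen i)).Reachable (inFst q) (inFst (bendLink d i q)) :=
  (adj_inFst (bend hd ht) (gen i) q).reachable

lemma reachable_bend_cap : ((bend hd ht).concat (gen i)).Reachable
    (inFst (Sum.inr (fstPt i))) (inFst (Sum.inr (sndPt i))) := by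
  have h := (adj_inSnd (bend hd ht) (gen i) (Sum.inl (fstPt i))).reachable
  rwa [gen_link_inl, if_pos (show ((fstPt i : Fin n) : ℕ) = i from rfl)] at h

lemma reachable_bend_left : ((bend hd ht).concat (gen i)).Reachable (outer (Sum.inl (sndPt i)))
    (inFst (Sum.inr (sndPt i))) := by
  have h := reachable_bend_link hd ht (Sum.inl (sndPt i))
  rwa [bendLink_left] at h

/-- The path runs from the left point `i + 1` straight to the middle, through the left link of `gen
i` to the middle point `i`, and from there to the old partner. -/
lemma reachable_bend_partner : ((bend hd ht).concat (gen i)).Reachable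
    (outer (Sum.inl (sndPt i))) (outer (d.link (Sum.inl (sndPt i)))) := by
  obtain ⟨-, -, h2, h3, -⟩ := bend_aux hd
  have h := reachable_bend_link hd ht (Sum.inr (fstPt i))
  rw [bendLink_fst hd] at h
  exact ((reachable_bend_left hd ht).trans (reachable_bend_cap hd ht).symm).trans
    (h.trans (reachable_bend_mid hd ht h2 h3).symm)

lemma bend_comp_gen : (bend hd ht).comp (gen i) = d := by
  refine comp_eq_of_reachable fun q => ?_
  have hcup : ((bend hd ht).concat (gen i)).Reachable (outer (Sum.inr (fstPt i)))
      (outer (Sum.inr (sndPt i))) := by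
    have h := (adj_inSnd (bend hd ht) (gen i) (Sum.inr (fstPt i))).reachable
    rwa [gen_link_fstPt] at h
  rcases bendLink_cases d i q with rfl | rfl | rfl | rfl | ⟨h1, h2, h3, h4⟩
  · exact reachable_bend_partner hd ht
  · rw [(bend_aux hd).1]
    exact hcup.symm
  · rw [d.link_link]
    exact (reachable_bend_partner hd ht).symm
  · rw [hd]
    exact hcup
  · obtain ⟨l1, l2, l3, l4⟩ := link_other hd h1 h2 h3 h4
    have h := reachable_bend_link hd ht q
    rw [bendLink_other h1 h2 h3 h4] at h
    exact ((reachable_bend_mid hd ht h2 h4).trans h).trans (reachable_bend_mid hd ht l2 l4).symm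

lemma loops_bend_gen : loops (bend hd ht) (gen i) = 0 := by
  refine loops_eq_zero fun k => ?_
  by_cases h2 : k = sndPt i
  · subst h2
    exact ⟨_, reachable_bend_left hd ht⟩
  by_cases h4 : k = fstPt i
  · subst h4
    exact ⟨_, (reachable_bend_left hd ht).trans (reachable_bend_cap hd ht).symm⟩
  · exact ⟨Sum.inr k, reachable_bend_mid hd ht (fun h => h2 (Sum.inr_injective h))
      (fun h => h4 (Sum.inr_injective h))⟩

end NDiagram

namespace NDiagramAlgebra

open NDiagram

lemma ofDiagram_mem_adjoin_of_trivialFrom {n : ℕ} (β : ℂ) (m : ℕ) (hm : m ≤ n) (d : NDiagram n)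
    (ht : d.TrivialFrom m) : ofDiagram β d ∈
      Algebra.adjoin ℂ (Set.range fun i : Fin (n - 1) => ofDiagram β (gen i)) := by
  induction m generalizing d with
  | zero =>
    have : d = NDiagram.one n := NDiagram.ext (funext fun p => by
      rcases p with k | k
      · exact ht k (Nat.zero_le _)
      · rw [← ht k (Nat.zero_le _), d.link_link, ht k (Nat.zero_le _)]; rfl)
    rw [this]
    exact one_mem _
  | succ m ih =>
    have hgen : ∀ i : Fin (n - 1), ofDiagram β (gen i) ∈
        Algebra.adjoin ℂ (Set.range fun i : Fin (n - 1) => ofDiagram β (gen i)) :=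
      fun i => Algebra.subset_adjoin ⟨i, rfl⟩
    by_cases hcup : ∃ i : Fin (n - 1), d.link (Sum.inr (fstPt i)) = Sum.inr (sndPt i)
    · obtain ⟨i, hd⟩ := hcup
      -- Otherwise the right point `i + 1` would belong to a straight link.
      have him : (i : ℕ) + 2 ≤ m + 1 := by
        by_contra hlt
        have h := ht (sndPt i) (by simp only [sndPt]; omega)
        have h' := congrArg d.link hd
        rw [d.link_link, ← h, d.link_link] at h'
        simp at h'
      -- The inner induction is on the distance `g` of the link from the last position where it can
      -- occur.
      obtain ⟨g, hg⟩ : ∃ g, (i : ℕ) + 2 + g = m + 1 := ⟨m + 1 - (i + 2), by omega⟩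
      clear him
      induction g generalizing d i with
      | zero =>
        have him : (i : ℕ) + 1 = m := by omega
        have ht' : d.TrivialFrom (i + 2) := fun k hk => ht k (by omega)
        have h := ofDiagram_mul (β := β) (bend hd ht') (gen i)
        rw [bend_comp_gen, loops_bend_gen, pow_zero, one_smul] at h
        rw [← h]
        exact mul_mem (ih (by omega) _ (him ▸ trivialFrom_bend hd ht')) (hgen i)
      | succ g ihg =>
        have hi : (i : ℕ) + 1 < n - 1 := by omega
        -- The link moves one step down to `i + 1`. Since `i + 3 ≤ m + 1`, the strands from `m + 1`
        -- on stay straight.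
        rw [ofDiagram_mul_gen_mul_gen (j := ⟨i + 1, hi⟩) (Or.inl rfl) hd]
        refine mul_mem (ihg _ (ht.comp (trivialFrom_gen _ ?_)) _ (comp_gen_link d _) ?_) (hgen i)
        · simp only; omega
        · simp only; omega
    · rw [eq_one_of_no_cup (not_exists.1 hcup)]
      exact one_mem _

/-- The diagrams of the generators generate the diagram algebra. -/
lemma adjoin_gen_eq_top (n : ℕ) (β : ℂ) :
    Algebra.adjoin ℂ (Set.range fun i : Fin (n - 1) => ofDiagram β (gen i)) = ⊤ := by
  refine top_le_iff.1 fun a _ => ?_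
  induction a using NDiagramAlgebra.induction with
  | h0 => exact zero_mem _
  | hadd a b ha hb => exact add_mem (ha trivial) (hb trivial)
  | hs d x =>
    have h := ofDiagram_mem_adjoin_of_trivialFrom β n le_rfl d fun k hk => absurd k.2 (by omega)
    have := Subalgebra.smul_mem _ h x
    rwa [ofDiagram, smul_single, mul_one] at this

end NDiagramAlgebra

/-! ## Lower bound for the number of diagrams -/

namespace BinaryTree

/-- The non-crossing matching of `0, …, 2 * t.numNodes - 1` attached to a binary tree. -/
def matching : BinaryTree Unit → ℕ → ℕ
  | nil, x => x
  | node _ l r, x =>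
    if x = 0 then 2 * l.numNodes + 1
    else if x < 2 * l.numNodes + 1 then matching l (x - 1) + 1
    else if x = 2 * l.numNodes + 1 then 0
    else matching r (x - (2 * l.numNodes + 2)) + (2 * l.numNodes + 2)

lemma matching_zero (l r : BinaryTree Unit) :
    matching (node () l r) 0 = 2 * l.numNodes + 1 := by simp [matching]

lemma matching_last (l r : BinaryTree Unit) :
    matching (node () l r) (2 * l.numNodes + 1) = 0 := by simp [matching]

lemma matching_left (l r : BinaryTree Unit) {x : ℕ} (hx : x < 2 * l.numNodes) :
    matching (node () l r) (x + 1) = matching l x + 1 := by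
  simp [matching, hx]

lemma matching_right (l r : BinaryTree Unit) (x : ℕ) :
    matching (node () l r) (x + (2 * l.numNodes + 2)) =
      matching r x + (2 * l.numNodes + 2) := by
  rw [matching, if_neg (by omega), if_neg (by omega), if_neg (by omega), Nat.add_sub_cancel]

/-- The four cases are the two ends of the link of `0`, the block of the left subtree inside it, and
the block of the right subtree after it. -/
lemma node_cases (a x : ℕ) :
    x = 0 ∨ (∃ y < 2 * a, x = y + 1) ∨ x = 2 * a + 1 ∨ ∃ y, x = y + (2 * a + 2) := by
  rcases Nat.lt_or_ge x (2 * a + 2) with h | h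
  · rcases Nat.eq_zero_or_pos x with h0 | h0
    · exact Or.inl h0
    · rcases Nat.lt_or_ge x (2 * a + 1) with h1 | h1
      · exact Or.inr (Or.inl ⟨x - 1, by omega, by omega⟩)
      · exact Or.inr (Or.inr (Or.inl (by omega)))
  · exact Or.inr (Or.inr (Or.inr ⟨x - (2 * a + 2), by omega⟩))

lemma matching_lt (t : BinaryTree Unit) {x : ℕ} (hx : x < 2 * t.numNodes) :
    matching t x < 2 * t.numNodes := by
  induction t generalizing x with
  | nil => simp at hx
  | node _ l r hl hr =>
    simp only [numNodes] at hx ⊢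
    rcases node_cases l.numNodes x with rfl | ⟨y, hy, rfl⟩ | rfl | ⟨y, rfl⟩
    · rw [matching_zero]; omega
    · rw [matching_left l r hy]
      have := hl hy
      omega
    · rw [matching_last]; omega
    · rw [matching_right]
      have := hr (x := y) (by omega)
      omega

lemma matching_matching (t : BinaryTree Unit) {x : ℕ} (hx : x < 2 * t.numNodes) :
    matching t (matching t x) = x := by
  induction t generalizing x with
  | nil => simp at hx
  | node _ l r hl hr =>
    simp only [numNodes] at hx
    rcases node_cases l.numNodes x with rfl | ⟨y, hy, rfl⟩ | rfl | ⟨y, rfl⟩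
    · rw [matching_zero, matching_last]
    · rw [matching_left l r hy, matching_left l r (matching_lt l hy), hl hy]
    · rw [matching_last, matching_zero]
    · rw [matching_right, matching_right, hr (by omega)]

lemma matching_ne (t : BinaryTree Unit) {x : ℕ} (hx : x < 2 * t.numNodes) : matching t x ≠ x := by
  induction t generalizing x with
  | nil => simp at hx
  | node _ l r hl hr =>
    simp only [numNodes] at hx
    rcases node_cases l.numNodes x with rfl | ⟨y, hy, rfl⟩ | rfl | ⟨y, rfl⟩
    · rw [matching_zero]; omega
    · rw [matching_left l r hy]
      have := hl hy
      omega
    · rw [matching_last]; omega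
    · rw [matching_right]
      have := hr (x := y) (by omega)
      omega

lemma matching_planar (t : BinaryTree Unit) {x y : ℕ} (hx : x < 2 * t.numNodes)
    (hy : y < 2 * t.numNodes) :
    ¬ (x < y ∧ y < matching t x ∧ matching t x < matching t y) := by
  induction t generalizing x y with
  | nil => simp at hx
  | node v l r hl hr =>
    cases v
    simp only [numNodes] at hx hy
    rcases node_cases l.numNodes x with rfl | ⟨x, hx', rfl⟩ | rfl | ⟨x, rfl⟩ <;>
    rcases node_cases l.numNodes y with rfl | ⟨y, hy', rfl⟩ | rfl | ⟨y, rfl⟩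
    case inr.inl.inr.inl =>
      rw [matching_left l r hx', matching_left l r hy']
      have := hl hx' hy'
      omega
    case inr.inr.inr.inr.inr.inr =>
      rw [matching_right, matching_right]
      have := hr (x := x) (y := y) (by omega) (by omega)
      omega
    -- In the remaining cases the links come from different pieces, which occupy nested or disjoint
    -- intervals, or are both the link of `0`.
    all_goals
      try rw [matching_left l r hx']
      try rw [matching_left l r hy']
      try have h1 := matching_lt l hx'
      try have h2 := matching_lt l hy'
      try simp only [matching_zero, matching_last, matching_right]
      omega

/-- The partner of `0` reveals the size of the left subtree, and then the two blocks determine the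
subtrees. -/
lemma matching_injective {s t : BinaryTree Unit} (hn : s.numNodes = t.numNodes)
    (h : ∀ x < 2 * s.numNodes, matching s x = matching t x) : s = t := by
  induction s generalizing t with
  | nil =>
    cases t with
    | nil => rfl
    | node _ l r => simp [numNodes] at hn
  | node _ l r hl hr =>
    cases t with
    | nil => simp [numNodes] at hn
    | node _ l' r' =>
      simp only [numNodes] at hn h
      have h0 := h 0 (by omega)
      rw [matching_zero, matching_zero] at h0
      have hnl : l.numNodes = l'.numNodes := by omega
      have e1 : l = l' := hl hnl fun x hx => by
        have := h (x + 1) (by omega)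
        rw [matching_left l r hx, matching_left l' r' (by omega)] at this
        omega
      have e2 : r = r' := hr (by omega) fun x hx => by
        have := h (x + (2 * l.numNodes + 2)) (by omega)
        rw [matching_right, hnl, matching_right] at this
        omega
      rw [e1, e2]

end BinaryTree

namespace NDiagram

variable {n : ℕ}

lemma boundaryPos_lt (p : Fin n ⊕ Fin n) : boundaryPos p < 2 * n := by
  rcases p with k | k <;> simp only [boundaryPos] <;> omega

/-- The point at a given position on the boundary. -/
def pointAt (x : ℕ) (hx : x < 2 * n) : Fin n ⊕ Fin n :=
  if h : x < n then Sum.inl ⟨x, h⟩ else Sum.inr ⟨2 * n - 1 - x, by omega⟩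

lemma boundaryPos_pointAt (x : ℕ) (hx : x < 2 * n) : boundaryPos (pointAt x hx) = x := by
  rw [pointAt]
  split_ifs <;> simp only [boundaryPos]
  omega

/-- The diagram of a binary tree. -/
def ofTree (t : BinaryTree Unit) (ht : t.numNodes = n) : NDiagram n where
  link p := pointAt (t.matching (boundaryPos p)) (by
    subst ht; exact t.matching_lt (boundaryPos_lt p))
  link_link p := by
    subst ht
    apply boundaryPos_injective
    rw [boundaryPos_pointAt, boundaryPos_pointAt, t.matching_matching (boundaryPos_lt p)]
  link_ne p h := by
    subst ht
    have := congrArg boundaryPos h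
    rw [boundaryPos_pointAt] at this
    exact t.matching_ne (boundaryPos_lt p) this
  planar p q := by
    subst ht
    rw [boundaryPos_pointAt, boundaryPos_pointAt]
    exact t.matching_planar (boundaryPos_lt p) (boundaryPos_lt q)

lemma ofTree_injective (s t : BinaryTree Unit) (hs : s.numNodes = n) (ht : t.numNodes = n)
    (h : ofTree s hs = ofTree t ht) : s = t := by
  refine BinaryTree.matching_injective (hs.trans ht.symm) fun x hx => ?_
  rw [hs] at hx
  have h1 := congrArg (fun d : NDiagram n => boundaryPos (d.link (pointAt x hx))) h
  simpa only [ofTree, boundaryPos_pointAt] using h1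

lemma link_injective : Function.Injective (link (n := n)) := fun _ _ h => NDiagram.ext h

instance : Finite (NDiagram n) := Finite.of_injective _ link_injective

lemma catalan_le_card (n : ℕ) : catalan n ≤ Nat.card (NDiagram n) := by
  rw [← BinaryTree.treesOfNumNodesEq_card_eq_catalan, ← Nat.card_eq_finsetCard]
  refine Nat.card_le_card_of_injective
    (fun t => ofTree t.1 (BinaryTree.mem_treesOfNumNodesEq.1 t.2)) fun s t h => ?_
  exact Subtype.ext (ofTree_injective _ _ _ _ h)

end NDiagram

/-! ## The isomorphism -/

namespace TemperleyLieb

variable {n : ℕ} {β : ℂ}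

lemma u_mul_self (i : Fin (n - 1)) : u n β i * u n β i = β • u n β i := by
  simpa [u] using RingQuot.mkAlgHom_rel ℂ (Rel.sq (n := n) (β := β) i)

lemma u_mul_u_mul_u (i j : Fin (n - 1)) (h : (i : ℕ) + 1 = j ∨ (j : ℕ) + 1 = i) :
    u n β i * u n β j * u n β i = u n β i := by
  simpa [u] using RingQuot.mkAlgHom_rel ℂ (Rel.neighbour (n := n) (β := β) i j h)

lemma u_comm (i j : Fin (n - 1)) (h : (i : ℕ) + 2 ≤ j) :
    u n β i * u n β j = u n β j * u n β i := by
  have h' : 1 < |((i : ℕ) : ℤ) - ((j : ℕ) : ℤ)| := by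
    rw [lt_abs]
    omega
  simpa [u] using RingQuot.mkAlgHom_rel ℂ (Rel.comm (n := n) (β := β) i j h')

/-- The generators as a sequence, continued by zero. -/
noncomputable def gens (n : ℕ) (β : ℂ) (k : ℕ) : TemperleyLieb n β :=
  if h : k < n - 1 then u n β ⟨k, h⟩ else 0

lemma gens_of_lt {k : ℕ} (h : k < n - 1) : gens n β k = u n β ⟨k, h⟩ := dif_pos h

lemma tlFamily_gens (n : ℕ) (β : ℂ) : TLFamily β (n - 1) (gens n β) where
  sq i hi := by
    rw [gens_of_lt hi, u_mul_self]
  up i hi := by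
    rw [gens_of_lt hi, gens_of_lt (Nat.lt_of_succ_lt hi), u_mul_u_mul_u _ _ (Or.inl rfl)]
  down i hi := by
    rw [gens_of_lt hi, gens_of_lt (Nat.lt_of_succ_lt hi), u_mul_u_mul_u _ _ (Or.inr rfl)]
  comm i j hij hj := by
    rw [gens_of_lt hj, gens_of_lt (by omega : i < n - 1), u_comm _ _ hij]

lemma tail_gens_eq_top (n : ℕ) (β : ℂ) : TLFamily.tail (n - 1) (gens n β) 0 = ⊤ := by
  refine top_le_iff.1 fun x _ => ?_
  obtain ⟨y, rfl⟩ := RingQuot.mkAlgHom_surjective ℂ (Rel n β) x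
  induction y using FreeAlgebra.induction with
  | grade0 r => rw [AlgHom.commutes]; exact Subalgebra.algebraMap_mem _ r
  | grade1 i =>
    have h := TLFamily.mem_tail (u := gens n β) (Nat.zero_le i) i.2
    rwa [gens_of_lt i.2] at h
  | mul a b ha hb => rw [map_mul]; exact mul_mem (ha trivial) (hb trivial)
  | add a b ha hb => rw [map_add]; exact add_mem (ha trivial) (hb trivial)

/-- The homomorphism from the Temperley–Lieb algebra to the diagram algebra. -/
noncomputable def toDiagram (n : ℕ) (β : ℂ) : TemperleyLieb n β →ₐ[ℂ] NDiagramAlgebra n β :=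
  RingQuot.liftAlgHom ℂ ⟨FreeAlgebra.lift ℂ fun i => NDiagramAlgebra.ofDiagram β (NDiagram.gen i),
    by
      rintro _ _ (i | ⟨i, j, h⟩ | ⟨i, j, h⟩)
      · simpa using NDiagramAlgebra.gen_mul_gen i
      · simpa using NDiagramAlgebra.gen_mul_gen_mul_gen i j h
      · simp only [map_mul, FreeAlgebra.lift_ι_apply]
        -- The relation is imposed for both orders of the indices, while `gen_comm` assumes the
        -- smaller index first.
        rcases lt_abs.1 h with h | h
        · exact (NDiagramAlgebra.gen_comm j i (by omega)).symm
        · exact NDiagramAlgebra.gen_comm i j (by omega)⟩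

lemma toDiagram_u (i : Fin (n - 1)) :
    toDiagram n β (u n β i) = NDiagramAlgebra.ofDiagram β (NDiagram.gen i) := by
  simp [toDiagram, u]

lemma toDiagram_surjective (n : ℕ) (β : ℂ) : Function.Surjective (toDiagram n β) := by
  rw [← AlgHom.range_eq_top, ← top_le_iff, ← NDiagramAlgebra.adjoin_gen_eq_top, Algebra.adjoin_le_iff]
  rintro _ ⟨i, rfl⟩
  exact ⟨u n β i, toDiagram_u i⟩

end TemperleyLieb

instance NDiagramAlgebra.instFinite (n : ℕ) (β : ℂ) : Module.Finite ℂ (NDiagramAlgebra n β) :=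
  inferInstanceAs (Module.Finite ℂ (NDiagram n →₀ ℂ))

lemma NDiagramAlgebra.finrank_eq_card (n : ℕ) (β : ℂ) :
    Module.finrank ℂ (NDiagramAlgebra n β) = Nat.card (NDiagram n) :=
  Module.finrank_eq_nat_card_basis (Finsupp.basisSingleOne (R := ℂ) (ι := NDiagram n))

theorem mainTheorem7 (n : ℕ) (hn : 0 < n) (β : ℂ) :
    (∃ φ : TemperleyLieb n β ≃ₐ[ℂ] NDiagramAlgebra n β,
      ∀ i : Fin (n - 1),
        φ (TemperleyLieb.u n β i) = NDiagramAlgebra.ofDiagram β (NDiagram.gen i)) ∧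
    Module.Finite ℂ (TemperleyLieb n β) ∧
    Module.Finite ℂ (NDiagramAlgebra n β) ∧
    Module.finrank ℂ (TemperleyLieb n β) = Module.finrank ℂ (NDiagramAlgebra n β) ∧
    (Module.finrank ℂ (TemperleyLieb n β) : ℚ) =
      ((2 * n).choose n : ℚ) - ((2 * n).choose (n - 1) : ℚ) ∧
    (Module.finrank ℂ (TemperleyLieb n β) : ℚ) = 1 / ((n : ℚ) + 1) * ((2 * n).choose n : ℚ) ∧
    Module.finrank ℂ (TemperleyLieb n β) = catalan n := by
  classical
  obtain ⟨S, hS, hspan⟩ := (TemperleyLieb.tlFamily_gens n β).exists_spanning_top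
    (TemperleyLieb.tail_gens_eq_top n β)
  rw [Nat.sub_add_cancel hn] at hS
  have hfin : Module.Finite ℂ (TemperleyLieb n β) := ⟨⟨S, hspan⟩⟩
  have hle : Module.finrank ℂ (TemperleyLieb n β) ≤ catalan n := by
    rw [← finrank_top, ← hspan]
    exact (finrank_span_finset_le_card S).trans hS
  let f := (TemperleyLieb.toDiagram n β).toLinearMap
  have hsurj : Function.Surjective f := TemperleyLieb.toDiagram_surjective n β
  have hge : Module.finrank ℂ (NDiagramAlgebra n β) ≤ Module.finrank ℂ (TemperleyLieb n β) :=
    LinearMap.finrank_le_finrank_of_surjective hsurj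
  have hcard : catalan n ≤ Module.finrank ℂ (NDiagramAlgebra n β) := by
    rw [NDiagramAlgebra.finrank_eq_card]
    exact NDiagram.catalan_le_card n
  -- The cycle of inequalities closes here; it makes the surjection injective and identifies the
  -- dimension with `catalan n`.
  have heq : Module.finrank ℂ (TemperleyLieb n β) = Module.finrank ℂ (NDiagramAlgebra n β) :=
    le_antisymm (hle.trans hcard) hge
  have hcat : Module.finrank ℂ (TemperleyLieb n β) = catalan n :=
    le_antisymm hle (hcard.trans hge)
  have hinj : Function.Injective f :=
    (LinearMap.injective_iff_surjective_of_finrank_eq_finrank heq).2 hsurj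
  have hcb : ((n : ℚ) + 1) * catalan n = ((2 * n).choose n : ℚ) := by
    have := succ_mul_catalan_eq_centralBinom n
    rw [Nat.centralBinom] at this
    exact_mod_cast this
  have hn1 : ((n : ℚ) + 1) ≠ 0 := by positivity
  refine ⟨⟨AlgEquiv.ofBijective (TemperleyLieb.toDiagram n β) ⟨hinj, hsurj⟩,
    TemperleyLieb.toDiagram_u⟩, hfin, inferInstance, heq, ?_, ?_, hcat⟩
  · rw [hcat]
    obtain ⟨m, rfl⟩ : ∃ m, n = m + 1 := ⟨n - 1, by omega⟩
    have h := Nat.choose_succ_right_eq (2 * (m + 1)) m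
    have h' : 2 * (m + 1) - m = m + 2 := by omega
    rw [h'] at h
    have hq : ((2 * (m + 1)).choose (m + 1) : ℚ) * (m + 1) =
        ((2 * (m + 1)).choose m : ℚ) * (m + 2) := by exact_mod_cast h
    rw [Nat.add_sub_cancel]
    -- After multiplication by `n + 1`, the identity `n * (2n choose n) = (n + 1) * (2n choose n -
    -- 1)` reduces the difference to `2n choose n`.
    refine mul_left_cancel₀ hn1 ?_
    push_cast at hcb hq ⊢
    linear_combination hcb - hq
  · rw [hcat, ← hcb, one_div, inv_mul_cancel_left₀ hn1]
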